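/- **Definitions.** Let $\Lambda$ be a $k$-graph ($k\ge 0$): a nonempty countable small category with a degree functor $d:\Lambda\to\mathbb N^k$ such that whenever $d(\lambda)=m+n$ there are unique $\mu,\nu\in\Lambda$ with $\lambda=\mu\nu$, $d(\mu)=m$, $d(\nu)=n$. Write $\Lambda^n=d^{-1}(n)$, identify objects with $\Lambda^0$, and let $r,s$ be the range (codomain) and source (domain) maps. For $C^*$-algebras $A,B$, an $A$-$B$ $C^*$-correspondence is a right Hilbert $B$-module $X$ with a $*$-homomorphism $\phi:A\to\mathcal L(X)$; $\otimes$ denotes the balanced (interior) tensor product, and $\mathcal K(X)$ the closed linear span of the operators $z\mapsto x\langle y,z\rangle$. $X$ is nondegenerate if $\overline{\operatorname{span}}\,\phi(A)X=X$, and full if the range of its inner product lies in no proper closed two-sided ideal of $B$. A $\Lambda$-system $(A,X,\chi)$ of $C^*$-correspondences consists of a $C^*$-algebra $A_v$ for each $v\in\Lambda^0$, an $A_{r(\lambda)}$-$A_{s(\lambda)}$ correspondence $X_\lambda$ (left action $\phi_\lambda$) for each $\lambda\in\Lambda$, and a map of correspondences $\chi_{\alpha,\beta}:X_\alpha\otimes_{A_{s(\alpha)}}X_\beta\to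 X_{\alpha\beta}$ for each composable pair, which is an isomorphism if $\alpha\notin\Lambda^0$, such that $X_v=A_v$ (the identity correspondence) for $v\in\Lambda^0$; $\chi_{r(\lambda),\lambda}(a\otimes x)=\phi_\lambda(a)x$ and $\chi_{\lambda,s(\lambda)}(x\otimes a)=x\cdot a$; and $\chi_{\alpha\beta,\gamma}(\chi_{\alpha,\beta}\otimes 1)=\chi_{\alpha,\beta\gamma}(1\otimes\chi_{\beta,\gamma})$ for composable $\alpha,\beta,\gamma$. It is regular if $v\Lambda^n=\{\lambda\in\Lambda^n: r(\lambda)=v\}$ is finite and nonempty for all $v\in\Lambda^0$, $n\in\mathbb N^k$, and each $X_\lambda$ is nondegenerate and full with $\phi_\lambda$ injective and $\phi_\lambda(A_{r(\lambda)})\subseteq\mathcal K(X_\lambda)$. A product system over $\mathbb N^k$ of correspondences over a $C^*$-algebra $A$ is a family $(Y_n)_{n\in\mathbb N^k}$ of $A$-$A$ correspondences with an associative multiplication on $\bigsqcup_n Y_n$ mapping $Y_m\times Y_n$ to $Y_{m+n}$, such that $Y_0=A$ is the identity correspondence, multiplication by elements of $Y_0=A$ is the given left and right action of $A$ on each $Y_n$,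 and for $m,n\neq 0$ there is an isomorphism of correspondences $\Theta_{m,n}:Y_m\otimes_AY_n\to Y_{m+n}$ with $\Theta_{m,n}(x\otimes y)=xy$. It is nondegenerate if every $Y_n$ is. **Proposition.** Let $(A,X,\chi)$ be a $\Lambda$-system of $C^*$-correspondences. Let $A=\bigoplus_{v\in\Lambda^0}A_v$ be the $c_0$-direct sum, regard each $X_\lambda$ as an $A$-$A$ correspondence through the coordinates $r(\lambda)$ (left) and $s(\lambda)$ (right), let $Y_n=\bigoplus_{\lambda\in\Lambda^n}X_\lambda$ be the $\ell^2$-direct sum, and let $\iota_\lambda:X_\lambda\to Y_{d(\lambda)}$ be the inclusions. 1. There is exactly one product system structure over $\mathbb N^k$ on $Y=\bigsqcup_{n\in\mathbb N^k}Y_n$ for which $Y_0$ is identified with $A$ by sending $\iota_v(a)$ to the copy of $a\in A_v$ in $A$, and for which $$\iota_\alpha(x)\,\iota_\beta(y)=\begin{cases}\iota_{\alpha\beta}(\chi_{\alpha,\beta}(x\otimes y)) & \text{if } s(\alpha)=r(\beta),\\ 0 & \text{otherwise}\end{cases}\qquad(\alpha,\beta\in\Lambda,\ x\in X_\alpha,\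 y\in X_\beta).$$ 2. If $X$ is regular, then $Y$ is nondegenerate, and for every $n\in\mathbb N^k$ the left action of $A$ on $Y_n$ is an injective homomorphism of $A$ into $\mathcal K(Y_n)$. -/

import Mathlib

open scoped ComplexConjugate TensorProduct CategoryTheory

universe u v w w'

/-- Positivity in a C⋆-algebra: `b = c⋆c` for some `c`. -/
def IsCStarPositive {B : Type*} [NonUnitalCStarAlgebra B] (b : B) : Prop :=
  ∃ c : B, b = star c * c

theorem isCStarPositive_iff {B : Type*} [NonUnitalCStarAlgebra B] (b : B) :
    IsCStarPositive b ↔ letI := CStarAlgebra.spectralOrder B; 0 ≤ b := by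
  let _ := CStarAlgebra.spectralOrder B
  have := CStarAlgebra.spectralOrderedRing B
  exact CStarAlgebra.nonneg_iff_eq_star_mul_self.symm

/-- A right Hilbert module over the C⋆-algebra `B`; `ract x b` is `x · b`, and the inner product is
conjugate linear in the first and linear in the second variable.  Definiteness of the inner product
is contained in `norm_sq`.  (Mathlib's `CStarModule` is about left actions,
`⟪x, a • y⟫ = a * ⟪x, y⟫`.) -/
structure HilbertModule (B : Type u) [NonUnitalCStarAlgebra B] where
  carrier : Type w
  [normedAddCommGroup : NormedAddCommGroup carrier]
  [normedSpace : NormedSpace ℂ carrier]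
  [completeSpace : CompleteSpace carrier]
  inner : carrier →ₗ⋆[ℂ] carrier →ₗ[ℂ] B
  ract : carrier →ₗ[ℂ] B →ₗ[ℂ] carrier
  ract_mul : ∀ x b c, ract x (b * c) = ract (ract x b) c
  inner_ract : ∀ x y b, inner x (ract y b) = inner x y * b
  star_inner : ∀ x y, star (inner x y) = inner y x
  inner_self_pos : ∀ x, IsCStarPositive (inner x x)
  norm_sq : ∀ x, ‖x‖ ^ 2 = ‖inner x x‖

attribute [instance] HilbertModule.normedAddCommGroup HilbertModule.normedSpace
  HilbertModule.completeSpace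

/-- An `A`-`B` C⋆-correspondence: a right Hilbert `B`-module with a ⋆-homomorphism `lact` from `A`
to the adjointable operators; `inner_lact` says that `lact a` is adjointable with adjoint
`lact (star a)`. -/
structure CStarCorr (A : Type u) (B : Type v) [NonUnitalCStarAlgebra A] [NonUnitalCStarAlgebra B]
    extends HilbertModule.{v, w} B where
  lact : A →ₙₐ[ℂ] (carrier →L[ℂ] carrier)
  inner_lact : ∀ a x y, inner (lact a x) y = inner x (lact (star a) y)

instance (A : Type u) (B : Type v) [NonUnitalCStarAlgebra A] [NonUnitalCStarAlgebra B] :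
    CoeSort (CStarCorr.{u, v, w} A B) (Type w) := ⟨fun X => X.carrier⟩

/-- The algebraic data from which a C⋆-correspondence is obtained by dividing out the vectors of
length zero and completing: the inner product need not be definite, and the space need not be
complete. -/
structure PreCStarCorr (A : Type u) (B : Type v) [NonUnitalCStarAlgebra A]
    [NonUnitalCStarAlgebra B] where
  carrier : Type w
  [addCommGroup : AddCommGroup carrier]
  [module : Module ℂ carrier]
  inner : carrier →ₗ⋆[ℂ] carrier →ₗ[ℂ] B
  ract : carrier →ₗ[ℂ] B →ₗ[ℂ] carrier
  ract_mul : ∀ x b c, ract x (b * c) = ract (ract x b) c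
  inner_ract : ∀ x y b, inner x (ract y b) = inner x y * b
  star_inner : ∀ x y, star (inner x y) = inner y x
  inner_self_pos : ∀ x, IsCStarPositive (inner x x)
  lact : A →ₗ[ℂ] carrier →ₗ[ℂ] carrier
  lact_mul : ∀ a b x, lact (a * b) x = lact a (lact b x)
  inner_lact : ∀ a x y, inner (lact a x) y = inner x (lact (star a) y)

namespace PreCStarCorr

attribute [instance] PreCStarCorr.addCommGroup PreCStarCorr.module

variable {A : Type u} {B : Type v} [NonUnitalCStarAlgebra A] [NonUnitalCStarAlgebra B]
  (V : PreCStarCorr.{u, v, w} A B)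

theorem inner_ract_left (x y : V.carrier) (b : B) :
    V.inner (V.ract x b) y = star b * V.inner x y := by
  rw [← V.star_inner, V.inner_ract, star_mul, V.star_inner]

theorem inner_smul_left (c : ℂ) (x y : V.carrier) :
    V.inner (c • x) y = conj c • V.inner x y := by
  rw [map_smulₛₗ, LinearMap.smul_apply]

theorem inner_smul_right (c : ℂ) (x y : V.carrier) :
    V.inner x (c • y) = c • V.inner x y := map_smul _ _ _

theorem norm_inner_sq_le (x y : V.carrier) :
    ‖V.inner x y‖ ^ 2 ≤ ‖V.inner x x‖ * ‖V.inner y y‖ := by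
  let _ := CStarAlgebra.spectralOrder B
  have := CStarAlgebra.spectralOrderedRing B
  set c := V.inner x y with hc
  have key : ∀ q : ℝ, ‖V.inner x x‖ < q → ‖c‖ ^ 2 ≤ q * ‖V.inner y y‖ := by
    intro q hq
    have hq0 : 0 < q := (norm_nonneg _).trans_lt hq
    have h1 : star c * V.inner x x * c ≤ q • (star c * c) :=
      (CStarAlgebra.star_left_conjugate_le_norm_smul
        (hb := ((isCStarPositive_iff _).1 (V.inner_self_pos x)).isSelfAdjoint)).trans
        (smul_le_smul_of_nonneg_right hq.le (star_mul_self_nonneg c))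
    have h2 : 0 ≤ V.inner (V.ract x c - (q : ℂ) • y) (V.ract x c - (q : ℂ) • y) :=
      (isCStarPositive_iff _).1 (V.inner_self_pos _)
    have h3 : V.inner (V.ract x c - (q : ℂ) • y) (V.ract x c - (q : ℂ) • y)
        = star c * V.inner x x * c - (2 * q) • (star c * c) + q ^ 2 • V.inner y y := by
      have h4 : V.inner y x = star c := (V.star_inner x y).symm
      rw [map_sub, map_sub, LinearMap.sub_apply, LinearMap.sub_apply, V.inner_smul_right,
        V.inner_smul_right, V.inner_smul_left, V.inner_smul_left, V.inner_ract, V.inner_ract,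
        V.inner_ract_left,
        V.inner_ract_left, h4, ← hc, Complex.conj_ofReal, smul_smul, ← Complex.ofReal_mul]
      simp only [Complex.coe_smul, mul_assoc, two_mul, add_smul, pow_two]
      abel
    have h5 : star c * c ≤ q • V.inner y y := by
      have h6 : q • (star c * c) ≤ q • (q • V.inner y y) := by
        rw [h3] at h2
        have h7 : (2 * q) • (star c * c) = q • (star c * c) + q • (star c * c) := by
          rw [two_mul, add_smul]
        rw [h7] at h2
        have h8 := add_le_add_left h1 (q • (q • V.inner y y) - q • (star c * c))
        rw [smul_smul, ← pow_two] at h8 ⊢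
        rw [← sub_nonneg]
        refine h2.trans ?_
        rw [← sub_nonneg] at h1 ⊢
        convert h1 using 1
        abel
      exact (smul_le_smul_iff_of_pos_left hq0).1 h6
    have h9 := CStarAlgebra.norm_le_norm_of_nonneg_of_le (star_mul_self_nonneg c) h5
    rwa [CStarRing.norm_star_mul_self, ← pow_two, norm_smul, Real.norm_of_nonneg hq0.le] at h9
  refine ge_of_tendsto (x := nhdsWithin ‖V.inner x x‖ (Set.Ioi ‖V.inner x x‖))
    (f := fun q : ℝ => q * ‖V.inner y y‖) ?_ ?_
  · exact tendsto_nhdsWithin_of_tendsto_nhds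
      ((continuous_id.mul continuous_const).tendsto _)
  · filter_upwards [self_mem_nhdsWithin] with q hq using key q hq

theorem norm_inner_lact_le (a : A) (x : V.carrier) :
    ‖V.inner (V.lact a x) (V.lact a x)‖ ≤ ‖a‖ ^ 2 * ‖V.inner x x‖ := by
  let _ := CStarAlgebra.spectralOrder B
  have := CStarAlgebra.spectralOrderedRing B
  let _ := CStarAlgebra.spectralOrder (Unitization ℂ A)
  have := CStarAlgebra.spectralOrderedRing (Unitization ℂ A)
  have h1 : star (a : Unitization ℂ A) * a ≤ algebraMap ℝ _ (‖(a : Unitization ℂ A)‖ ^ 2) :=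
    CStarAlgebra.star_mul_le_algebraMap_norm_sq
  obtain ⟨d, hd⟩ := CStarAlgebra.nonneg_iff_eq_star_mul_self.1 (sub_nonneg.2 h1)
  rw [Unitization.norm_inr, sub_eq_add_neg] at hd
  have hf := congrArg (fun z => z.fst) hd
  have hs := congrArg (fun z => z.snd) hd
  have hf' : ((‖a‖ ^ 2 : ℝ) : ℂ) = conj d.fst * d.fst := by
    simpa [Algebra.algebraMap_eq_smul_one] using hf
  have hs' : -(star a * a) = conj d.fst • d.snd + (d.fst • star d.snd + star d.snd * d.snd) := by
    simpa [Algebra.algebraMap_eq_smul_one, add_assoc] using hs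
  have h2 : 0 ≤ V.inner (d.fst • x + V.lact d.snd x) (d.fst • x + V.lact d.snd x) :=
    (isCStarPositive_iff _).1 (V.inner_self_pos _)
  have h3 : V.inner (d.fst • x + V.lact d.snd x) (d.fst • x + V.lact d.snd x)
      = (‖a‖ ^ 2 : ℝ) • V.inner x x - V.inner (V.lact a x) (V.lact a x) := by
    have h4 : V.inner (V.lact a x) (V.lact a x) = V.inner x (V.lact (star a * a) x) := by
      rw [V.inner_lact, V.lact_mul]
    have h5 := congrArg (fun t => V.inner x (V.lact t x)) hs'
    simp only [map_neg, LinearMap.neg_apply, map_add, LinearMap.add_apply, map_smul,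
      LinearMap.smul_apply, V.lact_mul] at h5
    rw [sub_eq_add_neg, h4, V.lact_mul, h5, ← Complex.coe_smul, hf']
    rw [map_add, map_add, LinearMap.add_apply, LinearMap.add_apply, V.inner_smul_right,
      V.inner_smul_right,
      V.inner_smul_left, V.inner_smul_left, V.inner_lact, V.inner_lact, smul_smul,
      mul_comm d.fst]
    abel
  rw [h3, sub_nonneg] at h2
  have h9 := CStarAlgebra.norm_le_norm_of_nonneg_of_le
    ((isCStarPositive_iff _).1 (V.inner_self_pos (V.lact a x))) h2
  rwa [norm_smul, Real.norm_of_nonneg (by positivity)] at h9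

/-- `‖x‖ = ‖⟨x, x⟩‖ ^ (1/2)`. -/
noncomputable def seminorm : AddGroupSeminorm V.carrier where
  toFun x := √‖V.inner x x‖
  map_zero' := by simp
  neg' x := by simp
  add_le' x y := by
    rw [Real.sqrt_le_left (by positivity)]
    have h1 : ‖V.inner x y‖ ≤ √‖V.inner x x‖ * √‖V.inner y y‖ := by
      rw [← Real.sqrt_mul (norm_nonneg _)]
      exact Real.le_sqrt_of_sq_le (V.norm_inner_sq_le x y)
    have h2 : ‖V.inner y x‖ = ‖V.inner x y‖ := by rw [← V.star_inner, norm_star]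
    have h3 : V.inner (x + y) (x + y)
        = V.inner x x + V.inner x y + V.inner y x + V.inner y y := by
      simp only [map_add, LinearMap.add_apply]; abel
    rw [h3]
    have h4 := norm_add₄_le (a := V.inner x x) (b := V.inner x y) (c := V.inner y x)
      (d := V.inner y y)
    nlinarith [Real.sq_sqrt (norm_nonneg (V.inner x x)), Real.sq_sqrt (norm_nonneg (V.inner y y))]

noncomputable instance : SeminormedAddCommGroup V.carrier :=
  V.seminorm.toSeminormedAddCommGroup

theorem norm_def (x : V.carrier) : ‖x‖ = √‖V.inner x x‖ := rfl

theorem norm_sq (x : V.carrier) : ‖x‖ ^ 2 = ‖V.inner x x‖ := by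
  rw [norm_def, Real.sq_sqrt (norm_nonneg _)]

noncomputable instance : NormedSpace ℂ V.carrier where
  norm_smul_le c x := by
    rw [norm_def, norm_def, V.inner_smul_left, map_smul, smul_smul, norm_smul]
    simp [Real.sqrt_mul_self]

noncomputable def innerL : V.carrier →L⋆[ℂ] V.carrier →L[ℂ] B :=
  LinearMap.mkContinuous₂ V.inner 1 fun x y => by
    rw [one_mul, norm_def, norm_def, ← Real.sqrt_mul (norm_nonneg _)]
    exact Real.le_sqrt_of_sq_le (V.norm_inner_sq_le x y)

noncomputable def ractL : V.carrier →L[ℂ] B →L[ℂ] V.carrier :=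
  LinearMap.mkContinuous₂ V.ract 1 fun x b => by
    refine le_of_sq_le_sq ?_ (by positivity)
    rw [one_mul, mul_pow, norm_sq, norm_sq, V.inner_ract, V.inner_ract_left]
    calc ‖star b * V.inner x x * b‖ ≤ ‖star b‖ * ‖V.inner x x‖ * ‖b‖ :=
          (norm_mul_le _ _).trans (by gcongr; exact norm_mul_le _ _)
      _ = ‖V.inner x x‖ * ‖b‖ ^ 2 := by rw [norm_star]; ring

noncomputable def lactL : A →L[ℂ] V.carrier →L[ℂ] V.carrier :=
  LinearMap.mkContinuous₂ V.lact 1 fun a x => by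
    refine le_of_sq_le_sq ?_ (by positivity)
    rw [one_mul, mul_pow, norm_sq, norm_sq]
    exact V.norm_inner_lact_le a x

/-- The Hausdorff completion for the seminorm `‖⟨x, x⟩‖ ^ (1/2)`. -/
abbrev Compl : Type w := UniformSpace.Completion V.carrier

noncomputable def toCompl : V.carrier →L[ℂ] V.Compl := UniformSpace.Completion.toComplL

noncomputable def complInner : V.Compl →L⋆[ℂ] V.Compl →L[ℂ] B :=
  ((V.innerL.extend V.toCompl).flip.extend V.toCompl).flip

noncomputable def complRact : V.Compl →L[ℂ] B →L[ℂ] V.Compl :=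
  ((ContinuousLinearMap.compL ℂ B V.carrier V.Compl V.toCompl).comp V.ractL).extend V.toCompl

noncomputable def complLact : A →L[ℂ] V.Compl →L[ℂ] V.Compl :=
  (((ContinuousLinearMap.compL ℂ V.carrier V.carrier V.Compl V.toCompl).comp
    V.lactL).flip.extend V.toCompl).flip

theorem denseRange_toCompl : DenseRange V.toCompl := UniformSpace.Completion.denseRange_coe

theorem isUniformInducing_toCompl : IsUniformInducing V.toCompl :=
  UniformSpace.Completion.isUniformInducing_coe _

theorem complInner_coe (x y : V.carrier) :
    V.complInner (V.toCompl x) (V.toCompl y) = V.inner x y := by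
  rw [complInner, ContinuousLinearMap.flip_apply,
    ContinuousLinearMap.extend_eq _ V.denseRange_toCompl V.isUniformInducing_toCompl,
    ContinuousLinearMap.flip_apply,
    ContinuousLinearMap.extend_eq _ V.denseRange_toCompl V.isUniformInducing_toCompl]
  rfl

theorem complRact_coe (x : V.carrier) (b : B) :
    V.complRact (V.toCompl x) b = V.toCompl (V.ract x b) := by
  rw [complRact,
    ContinuousLinearMap.extend_eq _ V.denseRange_toCompl V.isUniformInducing_toCompl]
  rfl

theorem complLact_coe (a : A) (x : V.carrier) :
    V.complLact a (V.toCompl x) = V.toCompl (V.lact a x) := by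
  rw [complLact, ContinuousLinearMap.flip_apply,
    ContinuousLinearMap.extend_eq _ V.denseRange_toCompl V.isUniformInducing_toCompl]
  rfl

theorem complInner_star (x y : V.Compl) : star (V.complInner x y) = V.complInner y x := by
  refine V.denseRange_toCompl.induction_on₂ (isClosed_eq (by fun_prop) (by fun_prop)) ?_ x y
  intro x y
  rw [complInner_coe, complInner_coe, V.star_inner]

/-- The C⋆-correspondence obtained by Hausdorff completion. -/
noncomputable def completion : CStarCorr.{u, v, w} A B where
  carrier := V.Compl
  inner := V.complInner.toLinearMap₁₂
  ract := V.complRact.toLinearMap₁₂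
  ract_mul x b c := by
    change V.complRact x (b * c) = V.complRact (V.complRact x b) c
    refine V.denseRange_toCompl.induction_on x (isClosed_eq (by fun_prop) (by fun_prop)) ?_
    intro x
    rw [complRact_coe, complRact_coe, complRact_coe, V.ract_mul]
  inner_ract x y b := by
    change V.complInner x (V.complRact y b) = V.complInner x y * b
    refine V.denseRange_toCompl.induction_on₂ (isClosed_eq (by fun_prop) (by fun_prop)) ?_ x y
    intro x y
    rw [complRact_coe, complInner_coe, complInner_coe, V.inner_ract]
  star_inner x y := V.complInner_star x y
  inner_self_pos x := by
    let _ := CStarAlgebra.spectralOrder B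
    have := CStarAlgebra.spectralOrderedRing B
    change IsCStarPositive (V.complInner x x)
    rw [isCStarPositive_iff]
    refine V.denseRange_toCompl.induction_on x
      (isClosed_le continuous_const (by fun_prop)) ?_
    intro x
    rw [complInner_coe]
    exact (isCStarPositive_iff _).1 (V.inner_self_pos x)
  norm_sq x := by
    change ‖x‖ ^ 2 = ‖V.complInner x x‖
    refine V.denseRange_toCompl.induction_on x (isClosed_eq (by fun_prop) (by fun_prop)) ?_
    intro x
    rw [complInner_coe, ← V.norm_sq]
    exact congrArg (· ^ 2) (UniformSpace.Completion.norm_coe x)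
  lact :=
    { toFun := V.complLact
      map_smul' := map_smul _
      map_zero' := map_zero _
      map_add' := map_add _
      map_mul' := fun a b => by
        ext x
        change V.complLact (a * b) x = V.complLact a (V.complLact b x)
        refine V.denseRange_toCompl.induction_on x (isClosed_eq (by fun_prop) (by fun_prop)) ?_
        intro x
        rw [complLact_coe, complLact_coe, complLact_coe, V.lact_mul] }
  inner_lact a x y := by
    change V.complInner (V.complLact a x) y = V.complInner x (V.complLact (star a) y)
    refine V.denseRange_toCompl.induction_on₂ (isClosed_eq (by fun_prop) (by fun_prop)) ?_ x y
    intro x y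
    rw [complLact_coe, complLact_coe, complInner_coe, complInner_coe, V.inner_lact]

end PreCStarCorr

section Gram

variable {A : Type u} [NonUnitalCStarAlgebra A]

theorem exists_eq_star_mul_self_of_conj (G : A) (hG : IsSelfAdjoint G)
    (h : ∀ N L : A, star N = N → N * G * N = -(star L * L) → L = 0) :
    ∃ H : A, G = star H * H := by
  let _ := CStarAlgebra.spectralOrder A
  have := CStarAlgebra.spectralOrderedRing A
  obtain ⟨K, hK⟩ := CStarAlgebra.nonneg_iff_eq_star_mul_self.1 (CFC.negPart_nonneg G)
  have hNs : star (G⁻) = G⁻ := (CFC.negPart_nonneg G).isSelfAdjoint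
  have h4 : K * G⁻ = 0 := by
    refine h (G⁻) (K * G⁻) hNs ?_
    have h2 : G⁻ * G = -(G⁻ * G⁻) := by
      conv_lhs => enter [2]; rw [← CFC.posPart_sub_negPart G hG]
      rw [mul_sub, CFC.negPart_mul_posPart, zero_sub]
    rw [h2, star_mul, hNs]
    have h3 : G⁻ * star K * (K * G⁻) = G⁻ * (star K * K) * G⁻ := by simp only [mul_assoc]
    rw [h3, ← hK, neg_mul]
  have h12 : G⁻ = 0 := by
    have h13 : star (G⁻) * G⁻ = 0 := by
      rw [hNs]
      nth_rewrite 1 [hK]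
      rw [mul_assoc, h4, mul_zero]
    exact CStarRing.star_mul_self_eq_zero_iff _ |>.1 h13
  refine CStarAlgebra.nonneg_iff_eq_star_mul_self.1 ?_
  rw [← CFC.posPart_sub_negPart G hG, h12, sub_zero]
  exact CFC.posPart_nonneg G

/-- Gram matrices over a C⋆-algebra are positive. -/
theorem HilbertModule.gram_eq_star_mul_self (X : HilbertModule.{u, w} A) {n : Type*} [Fintype n]
    (x : n → X.carrier) :
    ∃ H : n → n → A, ∀ i j, X.inner (x i) (x j) = ∑ k, star (H k i) * H k j := by
  let _ := CStarAlgebra.spectralOrder A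
  have := CStarAlgebra.spectralOrderedRing A
  let G : CStarMatrix n n A := CStarMatrix.ofMatrix (Matrix.of fun i j => X.inner (x i) (x j))
  have hG : IsSelfAdjoint G := by
    ext i j
    exact X.star_inner (x j) (x i)
  obtain ⟨H, hH⟩ := exists_eq_star_mul_self_of_conj G hG fun N L hN hL => by
    ext k j
    have h5 : 0 ≤ (N * G * N) j j := by
      have h6 : (N * G * N) j j
          = X.inner (∑ i, X.ract (x i) (N i j)) (∑ i, X.ract (x i) (N i j)) := by
        have h7 : ∀ i, N j i = star (N i j) := fun i => by
          conv_lhs => rw [← hN]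
          rfl
        have h8 : ∀ y z b, X.inner (X.ract y b) z = star b * X.inner y z := fun y z b => by
          rw [← X.star_inner, X.inner_ract, star_mul, X.star_inner]
        simp only [CStarMatrix.mul_apply, map_sum, LinearMap.sum_apply, X.inner_ract, h8, h7,
          Finset.sum_mul]
        rfl
      rw [h6]
      exact (isCStarPositive_iff _).1 (X.inner_self_pos _)
    rw [hL] at h5
    have h9 : (star L * L) j j = ∑ l, star (L l j) * L l j := by
      rw [CStarMatrix.mul_apply]
      rfl
    have h10 : ∑ l, star (L l j) * L l j = 0 := by
      refine le_antisymm ?_ (Finset.sum_nonneg fun l _ => star_mul_self_nonneg _)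
      rw [← h9, ← neg_nonneg]
      exact h5
    have h11 := (Finset.sum_eq_zero_iff_of_nonneg
      (fun l _ => star_mul_self_nonneg (L l j))).1 h10 k (Finset.mem_univ k)
    exact CStarRing.star_mul_self_eq_zero_iff _ |>.1 h11
  refine ⟨fun i j => H i j, fun i j => ?_⟩
  have h15 : G i j = (star H * H) i j := by rw [← hH]
  rw [CStarMatrix.mul_apply] at h15
  exact h15

end Gram

namespace CStarCorr

section Tensor

universe x

variable {A : Type u} {B : Type v} {C : Type x} [NonUnitalCStarAlgebra A]
  [NonUnitalCStarAlgebra B] [NonUnitalCStarAlgebra C]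

theorem isCStarPositive_sum {ι : Type*} (s : Finset ι) (f : ι → B)
    (h : ∀ i ∈ s, IsCStarPositive (f i)) : IsCStarPositive (∑ i ∈ s, f i) := by
  let _ := CStarAlgebra.spectralOrder B
  have := CStarAlgebra.spectralOrderedRing B
  rw [isCStarPositive_iff]
  exact Finset.sum_nonneg fun i hi => (isCStarPositive_iff _).1 (h i hi)

theorem inner_ract_left (X : CStarCorr.{u, v, w} A B) (y z : X) (b : B) :
    X.inner (X.ract y b) z = star b * X.inner y z := by
  rw [← X.star_inner, X.inner_ract, star_mul, X.star_inner]

theorem lact_ract (X : CStarCorr.{u, v, w} A B) (a : A) (x : X) (b : B) :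
    X.lact a (X.ract x b) = X.ract (X.lact a x) b := by
  have h : ∀ z, X.inner z (X.lact a (X.ract x b)) = X.inner z (X.ract (X.lact a x) b) := by
    intro z
    have h1 : ∀ y, X.inner z (X.lact a y) = X.inner (X.lact (star a) z) y := fun y => by
      rw [X.inner_lact, star_star]
    rw [h1, X.inner_ract, X.inner_ract, h1]
  rw [← sub_eq_zero, ← norm_eq_zero, ← pow_eq_zero_iff two_ne_zero, X.norm_sq,
    map_sub, h, sub_self, norm_zero]

/-- `⟨x ⊗ y, x' ⊗ y'⟩ = ⟨y, ⟨x, x'⟩ · y'⟩` on the algebraic tensor product. -/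
noncomputable def tensorInner (X : CStarCorr.{u, v, w} A B) (Y : CStarCorr.{v, x, w'} B C) :
    X ⊗[ℂ] Y →ₗ⋆[ℂ] X ⊗[ℂ] Y →ₗ[ℂ] C :=
  TensorProduct.lift <| LinearMap.mk₂'ₛₗ (starRingEnd ℂ) (starRingEnd ℂ)
    (fun x y => TensorProduct.lift <| LinearMap.mk₂ ℂ
      (fun x' y' => Y.inner y (Y.lact (X.inner x x') y'))
      (by intros; simp) (by intros; simp) (by intros; simp) (by intros; simp))
    (by intros; ext; simp) (by intros; ext; simp)
    (by intros; ext; simp) (by intros; ext; simp)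

noncomputable def preTensor (X : CStarCorr.{u, v, w} A B) (Y : CStarCorr.{v, x, w'} B C) :
    PreCStarCorr.{u, x, max w w'} A C where
  carrier := X ⊗[ℂ] Y
  inner := tensorInner X Y
  ract := (LinearMap.lTensorHom X.carrier ∘ₗ Y.ract.flip).flip
  ract_mul t b c := by
    induction t with
    | zero => simp
    | add s t hs ht => simp only [map_add, LinearMap.add_apply, hs, ht]
    | tmul x y => simp [Y.ract_mul]
  inner_ract s t b := by
    induction s with
    | zero => simp
    | add s s' hs hs' => simp only [map_add, LinearMap.add_apply, hs, hs', add_mul]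
    | tmul x y =>
      induction t with
      | zero => simp
      | add s t hs ht => simp only [map_add, LinearMap.add_apply, hs, ht, add_mul]
      | tmul x' y' => simp [tensorInner, Y.inner_ract, Y.lact_ract]
  star_inner s t := by
    induction s with
    | zero => simp
    | add s s' hs hs' => simp only [map_add, LinearMap.add_apply, star_add, hs, hs']
    | tmul x y =>
      induction t with
      | zero => simp
      | add s t hs ht => simp only [map_add, LinearMap.add_apply, star_add, hs, ht]
      | tmul x' y' => 
        simp [tensorInner, Y.star_inner, Y.inner_lact, X.star_inner]
  inner_self_pos t := by
    obtain ⟨S, rfl⟩ := TensorProduct.exists_finset t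
    obtain ⟨H, hH⟩ := X.gram_eq_star_mul_self fun i : S => i.1.1
    have h : tensorInner X Y (∑ i ∈ S, i.1 ⊗ₜ[ℂ] i.2) (∑ i ∈ S, i.1 ⊗ₜ[ℂ] i.2)
        = ∑ k, Y.inner (∑ i : S, Y.lact (H k i) i.1.2) (∑ i : S, Y.lact (H k i) i.1.2) := by
      have hij : ∀ i j : S, tensorInner X Y (i.1.1 ⊗ₜ[ℂ] i.1.2) (j.1.1 ⊗ₜ[ℂ] j.1.2)
          = ∑ k, Y.inner (Y.lact (H k i) i.1.2) (Y.lact (H k j) j.1.2) := fun i j => by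
        change Y.inner _ (Y.lact (X.inner _ _) _) = _
        rw [hH i j, map_sum, sum_apply, map_sum]
        simp only [Y.inner_lact, map_mul, mul_apply_eq_comp]
      rw [← Finset.sum_coe_sort S]
      simp only [map_sum, LinearMap.sum_apply, hij]
      rw [Finset.sum_congr rfl fun _ _ => Finset.sum_comm, Finset.sum_comm]
    rw [h]
    exact isCStarPositive_sum _ _ fun k _ => Y.inner_self_pos _
  lact := LinearMap.mk₂ ℂ (fun a => LinearMap.rTensor Y.carrier (X.lact a : X →ₗ[ℂ] X))
    (by intros; simp [LinearMap.rTensor_add]) (by intros; simp [LinearMap.rTensor_smul])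
    (by intros; simp) (by intros; simp)
  lact_mul a b t := by
    induction t with
    | zero => simp
    | add s t hs ht => simp only [map_add, hs, ht]
    | tmul x y => simp
  inner_lact a s t := by
    induction s with
    | zero => simp
    | add s s' hs hs' => simp only [map_add, LinearMap.add_apply, hs, hs']
    | tmul x y =>
      induction t with
      | zero => simp
      | add s t hs ht => simp only [map_add, hs, ht]
      | tmul x' y' => simp [tensorInner, X.inner_lact]

/-- The balanced (interior) tensor product `X ⊗_B Y`: the Hausdorff completion of the algebraic
tensor product for `⟨x ⊗ y, x' ⊗ y'⟩ = ⟨y, ⟨x, x'⟩ · y'⟩`, with `(x ⊗ y) · c = x ⊗ (y · c)` and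
`a · (x ⊗ y) = (a · x) ⊗ y`. -/
noncomputable def tensor (X : CStarCorr.{u, v, w} A B) (Y : CStarCorr.{v, x, w'} B C) :
    CStarCorr.{u, x, max w w'} A C :=
  (preTensor X Y).completion

/-- The elementary tensor `x ⊗ y` in `X ⊗_B Y`. -/
noncomputable def tmul (X : CStarCorr.{u, v, w} A B) (Y : CStarCorr.{v, x, w'} B C) (x : X) (y : Y) :
    X.tensor Y :=
  (preTensor X Y).toCompl (x ⊗ₜ[ℂ] y)

end Tensor

section DirectSum

variable {A : Type u} {B : Type v} [NonUnitalCStarAlgebra A] [NonUnitalCStarAlgebra B]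

theorem finite_support_inner {ι : Type w'} (X : ι → CStarCorr.{u, v, w} A B)
    (x y : Π₀ i, (X i).carrier) :
    (Function.support fun i => (X i).inner (x i) (y i)).Finite := by
  refine x.finite_support.subset fun i hi => ?_
  contrapose! hi
  simp only [Set.mem_ofPred_eq, not_not] at hi
  simp [hi]

noncomputable def preDirectSum {ι : Type w'} (X : ι → CStarCorr.{u, v, w} A B) :
    PreCStarCorr.{u, v, max w' w} A B where
  carrier := Π₀ i, (X i).carrier
  inner := LinearMap.mk₂'ₛₗ (starRingEnd ℂ) (RingHom.id ℂ)
    (fun x y => ∑ᶠ i, (X i).inner (x i) (y i))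
    (fun x x' y => by
      rw [← finsum_add_distrib (finite_support_inner X x y) (finite_support_inner X x' y)]
      simp)
    (fun c x y => by
      rw [smul_finsum' _ (finite_support_inner X x y)]
      simp)
    (fun x y y' => by
      rw [← finsum_add_distrib (finite_support_inner X x y) (finite_support_inner X x y')]
      simp)
    (fun c x y => by
      rw [smul_finsum' _ (finite_support_inner X x y)]
      simp)
  ract := LinearMap.mk₂ ℂ (fun x b => x.mapRange (fun i z => (X i).ract z b) (by simp))
    (by intros; ext; simp) (by intros; ext; simp) (by intros; ext; simp) (by intros; ext; simp)
  ract_mul x b c := by ext i; simp [(X i).ract_mul]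
  inner_ract x y b := by
    simp only [LinearMap.mk₂'ₛₗ_apply, LinearMap.mk₂_apply, DFinsupp.mapRange_apply,
      HilbertModule.inner_ract]
    rw [finsum_mul' _ _ (finite_support_inner X x y)]
  star_inner x y := by
    simp only [LinearMap.mk₂'ₛₗ_apply]
    have h := (starAddEquiv : B ≃+ B).toAddMonoidHom.map_finsum (finite_support_inner X x y)
    refine h.trans (finsum_congr fun i => (X i).star_inner _ _)
  inner_self_pos x := by
    simp only [LinearMap.mk₂'ₛₗ_apply]
    rw [finsum_eq_sum _ (finite_support_inner X x x)]
    exact isCStarPositive_sum _ _ fun i _ => (X i).inner_self_pos _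
  lact := LinearMap.mk₂ ℂ (fun a x => x.mapRange (fun i z => (X i).lact a z) (by simp))
    (by intros; ext; simp) (by intros; ext; simp) (by intros; ext; simp) (by intros; ext; simp)
  lact_mul a b x := by ext i; simp
  inner_lact a x y := by
    simp [(X _).inner_lact]

/-- The `ℓ²`-direct sum of C⋆-correspondences: the completion of the algebraic direct sum for
`⟨x, y⟩ = ∑ i, ⟨x i, y i⟩`, with the coordinatewise actions. -/
noncomputable def directSum {ι : Type w'} (X : ι → CStarCorr.{u, v, w} A B) :
    CStarCorr.{u, v, max w' w} A B :=
  (preDirectSum X).completion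

open scoped Classical in
/-- The inclusion of the `i`-th summand. -/
noncomputable def directSumIncl {ι : Type w'} (X : ι → CStarCorr.{u, v, w} A B) (i : ι) (x : X i) :
    directSum X :=
  (preDirectSum X).toCompl (DFinsupp.single i x : Π₀ i, (X i).carrier)

end DirectSum

section Basic

variable {A : Type u} {B : Type v} [NonUnitalCStarAlgebra A] [NonUnitalCStarAlgebra B]

/-- The identity correspondence: `A` over itself, with `⟨x, y⟩ = star x * y` and multiplication on
both sides. -/
noncomputable def ident (A : Type u) [NonUnitalCStarAlgebra A] : CStarCorr.{u, u, u} A A where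
  carrier := A
  inner := LinearMap.mk₂'ₛₗ (starRingEnd ℂ) (RingHom.id ℂ) (fun x y => star x * y)
    (by intros; simp [add_mul]) (by intros; simp [smul_mul_assoc])
    (by intros; simp [mul_add]) (by intros; simp [mul_smul_comm])
  ract := LinearMap.mul ℂ A
  ract_mul x b c := by simp [mul_assoc]
  inner_ract x y b := by simp [mul_assoc]
  star_inner x y := by simp
  inner_self_pos x := ⟨x, rfl⟩
  norm_sq x := by simp [CStarRing.norm_star_mul_self, pow_two]
  lact := NonUnitalAlgHom.Lmul ℂ A
  inner_lact a x y := by simp [mul_assoc]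

/-- Maps of C⋆-correspondences: linear, compatible with both actions, preserving inner products. -/
structure Hom (X : CStarCorr.{u, v, w} A B) (Y : CStarCorr.{u, v, w'} A B)
    extends X.carrier →ₗ[ℂ] Y.carrier where
  map_inner : ∀ x y, Y.inner (toFun x) (toFun y) = X.inner x y
  map_ract : ∀ x b, toFun (X.ract x b) = Y.ract (toFun x) b
  map_lact : ∀ a x, toFun (X.lact a x) = Y.lact a (toFun x)

instance (X : CStarCorr.{u, v, w} A B) (Y : CStarCorr.{u, v, w'} A B) :
    CoeFun (Hom X Y) (fun _ => X → Y) := ⟨fun f => f.toLinearMap⟩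

def Hom.IsIso {X : CStarCorr.{u, v, w} A B} {Y : CStarCorr.{u, v, w'} A B} (f : Hom X Y) : Prop :=
  Function.Bijective f

def IsNondegenerate (X : CStarCorr.{u, v, w} A B) : Prop :=
  (Submodule.span ℂ {z : X | ∃ (a : A) (x : X), X.lact a x = z}).topologicalClosure = ⊤

/-- The range of the inner product lies in no proper closed two-sided ideal. -/
def IsFull (X : CStarCorr.{u, v, w} A B) : Prop :=
  ∀ I : TwoSidedIdeal B, IsClosed (I : Set B) → (∀ x y : X, X.inner x y ∈ I) → I = ⊤

/-- The underlying algebraic data. -/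
def toPreCStarCorr (X : CStarCorr.{u, v, w} A B) : PreCStarCorr.{u, v, w} A B where
  carrier := X.carrier
  inner := X.inner
  ract := X.ract
  ract_mul := X.ract_mul
  inner_ract := X.inner_ract
  star_inner := X.star_inner
  inner_self_pos := X.inner_self_pos
  lact := LinearMap.mk₂ ℂ (fun a x => X.lact a x) (by intros; simp) (by intros; simp)
    (by intros; simp) (by intros; simp)
  lact_mul a b x := by simp
  inner_lact := X.inner_lact

/-- The rank-one operator `z ↦ x · ⟨y, z⟩`. -/
noncomputable def rankOne (X : CStarCorr.{u, v, w} A B) (x y : X) : X →L[ℂ] X :=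
  LinearMap.mkContinuous (X.ract x ∘ₗ X.inner y) (‖x‖ * ‖y‖) fun z => by
    have hn : ∀ z : X, ‖z‖ = ‖(show X.toPreCStarCorr.carrier from z)‖ := fun z => by
      rw [← sq_eq_sq₀ (norm_nonneg _) (norm_nonneg _), X.norm_sq, PreCStarCorr.norm_sq]
      rfl
    have h1 : ‖X.ract x (X.inner y z)‖ ≤ ‖x‖ * ‖X.inner y z‖ := by
      have h := X.toPreCStarCorr.ractL.le_of_opNorm₂_le_of_le
        (LinearMap.mkContinuous₂_norm_le _ zero_le_one _)
        (le_refl ‖(show X.toPreCStarCorr.carrier from x)‖) (le_refl ‖X.inner y z‖)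
      rw [hn, hn x]
      rw [one_mul] at h
      exact h
    have h2 : ‖X.inner y z‖ ≤ ‖y‖ * ‖z‖ := by
      have h := X.toPreCStarCorr.innerL.le_of_opNorm₂_le_of_le
        (LinearMap.mkContinuous₂_norm_le _ zero_le_one _)
        (le_refl ‖(show X.toPreCStarCorr.carrier from y)‖) (le_refl ‖(show X.toPreCStarCorr.carrier from z)‖)
      rw [hn, hn z]
      rw [one_mul] at h
      exact h
    calc ‖X.ract x (X.inner y z)‖ ≤ ‖x‖ * ‖X.inner y z‖ := h1
      _ ≤ ‖x‖ * (‖y‖ * ‖z‖) := by gcongr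
      _ = ‖x‖ * ‖y‖ * ‖z‖ := by ring

/-- The compact operators: the closed linear span of the rank-one operators. -/
noncomputable def compactOperators (X : CStarCorr.{u, v, w} A B) : Submodule ℂ (X →L[ℂ] X) :=
  (Submodule.span ℂ {T | ∃ x y : X, T = X.rankOne x y}).topologicalClosure

end Basic
end CStarCorr

section C0Sum

open scoped ENNReal Topology

variable {V : Type w} (A : V → Type u) [∀ v, NonUnitalCStarAlgebra (A v)]

/-- The families `a ∈ ∏ A v` with `‖a v‖ → 0`, inside the `ℓ^∞`-direct sum. -/
def c0Subalgebra : NonUnitalStarSubalgebra ℂ (lp A ∞) where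
  carrier := {a | Filter.Tendsto (fun v => ‖a v‖) Filter.cofinite (𝓝 0)}
  add_mem' {a b} ha hb := by
    refine squeeze_zero (fun v => norm_nonneg _) (fun v => norm_add_le (a v) (b v)) ?_
    simpa using Filter.Tendsto.add ha hb
  zero_mem' := by simp [tendsto_const_nhds]
  mul_mem' {a b} ha hb := by
    refine squeeze_zero (fun v => norm_nonneg _) (fun v => norm_mul_le (a v) (b v)) ?_
    simpa using Filter.Tendsto.mul ha hb
  smul_mem' c a ha := by
    have h : Filter.Tendsto (fun v => ‖c‖ * ‖a v‖) Filter.cofinite (𝓝 (‖c‖ * 0)) :=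
      Filter.Tendsto.const_mul _ ha
    simpa [norm_smul] using h
  star_mem' {a} ha := by
    simpa using ha

instance c0Subalgebra_isClosed : IsClosed (c0Subalgebra A : Set (lp A ∞)) := by
  rw [← closure_subset_iff_isClosed]
  intro a ha
  change Filter.Tendsto (fun v => ‖a v‖) Filter.cofinite (𝓝 0)
  rw [Metric.tendsto_nhds]
  intro ε hε
  obtain ⟨b, hb, hab⟩ := Metric.mem_closure_iff.1 ha (ε / 2) (half_pos hε)
  have hb' : Filter.Tendsto (fun v => ‖b v‖) Filter.cofinite (𝓝 0) := hb
  filter_upwards [(Metric.tendsto_nhds.1 hb') (ε / 2) (half_pos hε)] with v hv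
  rw [Real.dist_0_eq_abs, abs_norm] at hv ⊢
  have h1 : ‖a v - b v‖ ≤ ‖a - b‖ := lp.norm_apply_le_norm ENNReal.top_ne_zero (a - b) v
  rw [dist_eq_norm] at hab
  have h2 : ‖a v‖ ≤ ‖a v - b v‖ + ‖b v‖ := by
    simpa using norm_add_le (a v - b v) (b v)
  linarith

/-- The `c₀`-direct sum of the C⋆-algebras `A v`. -/
abbrev C0Sum : Type (max w u) := c0Subalgebra A

open scoped Classical in
/-- The inclusion of the summand `A v`. -/
noncomputable def C0Sum.single (v : V) : A v →ₗ[ℂ] C0Sum A where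
  toFun a := ⟨lp.single ∞ v a, by
    refine tendsto_const_nhds.congr' ?_
    filter_upwards [(Set.finite_singleton v).compl_mem_cofinite] with j hj
    rw [lp.single_apply_ne _ _ _ hj, norm_zero]⟩
  map_add' a b := Subtype.ext (lp.single_add ∞ v a b)
  map_smul' c a := Subtype.ext (lp.single_smul ∞ v c a)

variable {A}

theorem C0Sum.single_mul (v : V) (a : A v) (b : C0Sum A) :
    C0Sum.single A v (a * b.1 v) = C0Sum.single A v a * b := by
  classical
  ext j
  change Pi.single v (a * b.1 v) j = Pi.single v a j * b.1 j
  rcases eq_or_ne j v with rfl | h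
  · simp
  · simp [Pi.single_eq_of_ne h]

theorem C0Sum.star_single (v : V) (a : A v) :
    star (C0Sum.single A v a) = C0Sum.single A v (star a) := by
  classical
  ext j
  change star (Pi.single v a j) = Pi.single v (star a) j
  rcases eq_or_ne j v with rfl | h
  · simp
  · simp [Pi.single_eq_of_ne h]

theorem C0Sum.norm_single (v : V) (a : A v) : ‖C0Sum.single A v a‖ = ‖a‖ := by
  classical
  exact lp.norm_single (p := ∞) (by simp) v a

/-- An `A r`-`A s` correspondence regarded as a correspondence over the `c₀`-direct sum `A`:
`b` acts on the left by `b r` and on the right by `b s`, and the inner product takes values in the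
summand `A s`. -/
noncomputable def CStarCorr.inflate {r s : V} (X : CStarCorr.{u, u, w'} (A r) (A s)) :
    CStarCorr.{max w u, max w u, w'} (C0Sum A) (C0Sum A) where
  carrier := X.carrier
  inner := X.inner.compr₂ₛₗ (C0Sum.single A s)
  ract := LinearMap.mk₂ ℂ (fun x b => X.ract x (b.1 s)) (by intros; simp) (by intros; simp)
    (by intros; simp) (by intros; simp)
  ract_mul x b c := by simp [X.ract_mul]
  inner_ract x y b := by simp [X.inner_ract, C0Sum.single_mul]
  star_inner x y := by simp [C0Sum.star_single, X.star_inner]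
  inner_self_pos x := by
    obtain ⟨c, hc⟩ := X.inner_self_pos x
    refine ⟨C0Sum.single A s c, ?_⟩
    rw [C0Sum.star_single, ← C0Sum.single_mul]
    change C0Sum.single A s (X.inner x x) = _
    rw [hc]
    congr 2
    classical
    exact (lp.single_apply_self ∞ s c).symm
  norm_sq x := (X.norm_sq x).trans (C0Sum.norm_single s _).symm
  lact :=
    { toFun := fun a => X.lact (a.1 r)
      map_smul' := by intros; simp
      map_zero' := by simp
      map_add' := by intros; simp
      map_mul' := by intros; simp }
  inner_lact a x y := by simp [X.inner_lact]

end C0Sum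

/-- A `k`-graph structure on the small category `Λ`.  A morphism `f : a ⟶ b` has source `a` and
range `b`, and the composite written `μν` is `ν ≫ μ`.  Objects are identified with the vertices,
that is, with the morphisms of degree zero (which are the identities by the factorisation
property). -/
structure KGraph (k : ℕ) (Λ : Type u) [CategoryTheory.Category.{v} Λ] where
  degree : ∀ {a b : Λ}, (a ⟶ b) → (Fin k → ℕ)
  degree_id : ∀ a : Λ, degree (𝟙 a) = 0
  degree_comp : ∀ {a b c : Λ} (μ : b ⟶ c) (ν : a ⟶ b), degree (ν ≫ μ) = degree μ + degree ν
  factorisation : ∀ {a b : Λ} (f : a ⟶ b) (m n : Fin k → ℕ), degree f = m + n →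
    ∃! p : Σ c : Λ, (c ⟶ b) × (a ⟶ c),
      degree p.2.1 = m ∧ degree p.2.2 = n ∧ p.2.2 ≫ p.2.1 = f
  nonempty : Nonempty Λ
  countable : Countable (Σ a b : Λ, (a ⟶ b))

/-- The set `Λⁿ` of paths of degree `n`. -/
structure KGraph.Path {k : ℕ} {Λ : Type u} [CategoryTheory.Category.{v} Λ] (D : KGraph k Λ)
    (n : Fin k → ℕ) where
  src : Λ
  rng : Λ
  hom : src ⟶ rng
  degree_eq : D.degree hom = n

/-- For every vertex `v` and every `n`, the set of paths of degree `n` with range `v` is finite and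
nonempty. -/
def KGraph.IsRowFiniteNoSources {k : ℕ} {Λ : Type u} [CategoryTheory.Category.{v} Λ]
    (D : KGraph k Λ) : Prop :=
  ∀ (v : Λ) (n : Fin k → ℕ),
    {p : D.Path n | p.rng = v}.Finite ∧ {p : D.Path n | p.rng = v}.Nonempty

universe a

/-- A `Λ`-system of C⋆-correspondences.  The identification of `X (𝟙 v)` with the identity
correspondence over `A v` is the isomorphism `unit v`.  Equations between elements of `X f` and
`X g` with `f = g` are stated in the disjoint union of the `X f`. -/
structure LambdaSystem {k : ℕ} {Λ : Type u} [CategoryTheory.Category.{v} Λ]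
    (D : KGraph k Λ) where
  A : Λ → Type a
  [cstar : ∀ v, NonUnitalCStarAlgebra (A v)]
  X : ∀ {u v : Λ} (_ : u ⟶ v), CStarCorr.{a, a, w} (A v) (A u)
  chi : ∀ {u v w : Λ} (α : v ⟶ w) (β : u ⟶ v), CStarCorr.Hom ((X α).tensor (X β)) (X (β ≫ α))
  chi_isIso : ∀ {u v w : Λ} (α : v ⟶ w) (β : u ⟶ v), D.degree α ≠ 0 → (chi α β).IsIso
  unit : ∀ v : Λ, CStarCorr.Hom (X (𝟙 v)) (CStarCorr.ident (A v))
  unit_isIso : ∀ v : Λ, (unit v).IsIso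
  chi_range : ∀ {u v : Λ} (f : u ⟶ v) (e : X (𝟙 v)) (x : X f),
    (⟨f ≫ 𝟙 v, chi (𝟙 v) f ((X (𝟙 v)).tmul (X f) e x)⟩ : Σ g : u ⟶ v, X g)
      = ⟨f, (X f).lact (unit v e) x⟩
  chi_source : ∀ {u v : Λ} (f : u ⟶ v) (x : X f) (e : X (𝟙 u)),
    (⟨𝟙 u ≫ f, chi f (𝟙 u) ((X f).tmul (X (𝟙 u)) x e)⟩ : Σ g : u ⟶ v, X g)
      = ⟨f, (X f).ract x (unit u e)⟩
  chi_assoc : ∀ {t u v w : Λ} (α : v ⟶ w) (β : u ⟶ v) (γ : t ⟶ u)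
    (x : X α) (y : X β) (z : X γ),
    (⟨γ ≫ (β ≫ α), chi (β ≫ α) γ ((X (β ≫ α)).tmul (X γ) (chi α β ((X α).tmul (X β) x y)) z)⟩ :
        Σ g : t ⟶ w, X g)
      = ⟨(γ ≫ β) ≫ α, chi α (γ ≫ β) ((X α).tmul (X (γ ≫ β)) x (chi β γ ((X β).tmul (X γ) y z)))⟩

attribute [instance] LambdaSystem.cstar

namespace LambdaSystem

variable {k : ℕ} {Λ : Type u} [CategoryTheory.Category.{v} Λ] {D : KGraph k Λ}

/-- Regular `Λ`-systems. -/
structure IsRegular (S : LambdaSystem.{u, v, w, a} D) : Prop where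
  rowFiniteNoSources : D.IsRowFiniteNoSources
  nondegenerate : ∀ {u v : Λ} (f : u ⟶ v), (S.X f).IsNondegenerate
  full : ∀ {u v : Λ} (f : u ⟶ v), (S.X f).IsFull
  injective : ∀ {u v : Λ} (f : u ⟶ v), Function.Injective (S.X f).lact
  compact : ∀ {u v : Λ} (f : u ⟶ v) (b : S.A v), (S.X f).lact b ∈ (S.X f).compactOperators

/-- The `C0Sum S.A`-correspondence `Yₙ`, the `ℓ²`-direct sum of the `X f` over the paths `f` of degree
`n`. -/
noncomputable def fibre (S : LambdaSystem.{u, v, w, a} D) (n : Fin k → ℕ) :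
    CStarCorr.{max u a, max u a, max u v w} (C0Sum S.A) (C0Sum S.A) :=
  CStarCorr.directSum fun p : D.Path n => (S.X p.hom).inflate

/-- The inclusion of `X f` in `Yₙ`, where `n` is the degree of `f`. -/
noncomputable def incl (S : LambdaSystem.{u, v, w, a} D) {n : Fin k → ℕ} {s r : Λ} (f : s ⟶ r)
    (hf : D.degree f = n) (x : S.X f) : S.fibre n :=
  CStarCorr.directSumIncl (fun p : D.Path n => (S.X p.hom).inflate) ⟨s, r, f, hf⟩ x

end LambdaSystem

/-- The structure of a product system over `P` (written additively) on a family `Y` of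
`A`-`A` C⋆-correspondences: a multiplication which makes the disjoint union of the `Y p` a
semigroup, an identification `unit` of `Y 0` with the identity correspondence, isomorphisms
`Y p ⊗_A Y q ≅ Y (p + q)` for `p, q ≠ 0` induced by the multiplication, and multiplication by
elements of `Y 0 = A` is the given left and right action. -/
structure ProductSystem {P : Type v} [AddMonoid P] {A : Type u} [NonUnitalCStarAlgebra A]
    (Y : P → CStarCorr.{u, u, w} A A) where
  mul : ∀ {p q : P}, Y p → Y q → Y (p + q)
  mul_assoc : ∀ {p q r : P} (x : Y p) (y : Y q) (z : Y r),
    (⟨p + q + r, mul (mul x y) z⟩ : Σ p, Y p) = ⟨p + (q + r), mul x (mul y z)⟩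
  unit : CStarCorr.Hom (Y 0) (CStarCorr.ident A)
  unit_isIso : unit.IsIso
  exists_iso : ∀ p q : P, p ≠ 0 → q ≠ 0 →
    ∃ Θ : CStarCorr.Hom ((Y p).tensor (Y q)) (Y (p + q)), Θ.IsIso ∧
      ∀ (x : Y p) (y : Y q), Θ ((Y p).tmul (Y q) x y) = mul x y
  unit_mul : ∀ {p : P} (e : Y 0) (y : Y p),
    (⟨0 + p, mul e y⟩ : Σ p, Y p) = ⟨p, (Y p).lact (unit e) y⟩
  mul_unit : ∀ {p : P} (y : Y p) (e : Y 0),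
    (⟨p + 0, mul y e⟩ : Σ p, Y p) = ⟨p, (Y p).ract y (unit e)⟩

-- Everything is controlled by one identity, `⟨xy, x'y'⟩ = ⟨y, ⟨x, x'⟩ · y'⟩`, checked on generators
-- `ι_α(x)`, `ι_β(y)` (`inner_mulComponent`). If the two pairs of paths coincide, it says that `χ`
-- preserves inner products. If they differ, the right side vanishes because distinct summands are
-- orthogonal. The left side vanishes because, with the degrees `m` and `n` fixed, unique
-- factorisation puts nonzero products of different pairs of paths into different summands of
-- `Y_{m+n}`.
--
-- The identity bounds the product by `‖x‖ ‖y‖`, so the product extends to the completions, where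
-- the identity persists (`exists_completionBilin`). It also says that `x ⊗ y ↦ xy` is isometric on
-- the balanced tensor product. The range of this isometry is therefore closed, and for `m ≠ 0` it
-- is everything: each path of degree `m + n` factors, the corresponding `χ` is onto, and elementary
-- tensors have dense span (`span_incl_chi_dense`). Paths of degree zero are identities, so `Y_0` is
-- `A`. Associativity and the unit laws are equations between bounded maps, and on generators they
-- are the axioms for `χ`.
--
-- For uniqueness, a product system multiplication is not assumed continuous. In nonzero degrees it
-- factors through the isometry `Θ`, and hence is determined by generators. If one degree is zero it
-- is an action of `A` through the unit map, which is isometric and so also determined by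
-- generators.
--
-- In the regular case, nondegeneracy passes from the summands to the closed span. An element `b`
-- acts on `X_λ` by its coordinate at `r(λ)`, and every vertex is the range of some path of degree
-- `n`, whence injectivity. An element supported at one vertex acts on only finitely many summands,
-- by compact operators. Such elements span a dense subspace of `A`, and the compact operators are
-- closed.

universe x w₁

/-! ### Norm estimates and maps of correspondences -/

namespace PreCStarCorr

variable {A : Type u} {B : Type v} [NonUnitalCStarAlgebra A] [NonUnitalCStarAlgebra B]

theorem completion_inner_toCompl (V : PreCStarCorr.{u, v, w} A B) (x y : V.carrier) :
    V.completion.inner (V.toCompl x) (V.toCompl y) = V.inner x y :=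
  V.complInner_coe x y

theorem completion_lact_toCompl (V : PreCStarCorr.{u, v, w} A B) (a : A) (x : V.carrier) :
    V.completion.lact a (V.toCompl x) = V.toCompl (V.lact a x) :=
  V.complLact_coe a x

end PreCStarCorr

namespace CStarCorr

variable {A : Type u} {B : Type v} {C : Type x} [NonUnitalCStarAlgebra A]
  [NonUnitalCStarAlgebra B] [NonUnitalCStarAlgebra C]

theorem norm_inner_le (X : CStarCorr.{u, v, w} A B) (x y : X) :
    ‖X.inner x y‖ ≤ ‖x‖ * ‖y‖ := by
  refine le_of_sq_le_sq ?_ (by positivity)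
  rw [mul_pow, X.norm_sq, X.norm_sq]
  exact X.toPreCStarCorr.norm_inner_sq_le x y

theorem norm_ract_le (X : CStarCorr.{u, v, w} A B) (x : X) (b : B) :
    ‖X.ract x b‖ ≤ ‖x‖ * ‖b‖ := by
  refine le_of_sq_le_sq ?_ (by positivity)
  rw [mul_pow, X.norm_sq, X.norm_sq, X.inner_ract, X.inner_ract_left]
  calc ‖star b * X.inner x x * b‖ ≤ ‖star b‖ * ‖X.inner x x‖ * ‖b‖ :=
        (norm_mul_le _ _).trans (by gcongr; exact norm_mul_le _ _)
    _ = ‖X.inner x x‖ * ‖b‖ ^ 2 := by rw [norm_star]; ring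

theorem norm_lact_le (X : CStarCorr.{u, v, w} A B) (a : A) (x : X) :
    ‖X.lact a x‖ ≤ ‖a‖ * ‖x‖ := by
  refine le_of_sq_le_sq ?_ (by positivity)
  rw [mul_pow, X.norm_sq, X.norm_sq]
  exact X.toPreCStarCorr.norm_inner_lact_le a x

/-- The inner product as a continuous sesquilinear map. -/
noncomputable def innerL (X : CStarCorr.{u, v, w} A B) : X →L⋆[ℂ] X →L[ℂ] B :=
  LinearMap.mkContinuous₂ X.inner 1 fun x y => by
    rw [one_mul]; exact X.norm_inner_le x y

/-- The right action as a continuous bilinear map. -/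
noncomputable def ractL (X : CStarCorr.{u, v, w} A B) : X →L[ℂ] B →L[ℂ] X :=
  LinearMap.mkContinuous₂ X.ract 1 fun x b => by
    rw [one_mul]; exact X.norm_ract_le x b

/-- The left action as a continuous bilinear map. -/
noncomputable def lactL (X : CStarCorr.{u, v, w} A B) : A →L[ℂ] X →L[ℂ] X :=
  LinearMap.mkContinuous₂ X.toPreCStarCorr.lact 1 fun a x => by
    rw [one_mul]; exact X.norm_lact_le a x

@[simp] theorem innerL_apply (X : CStarCorr.{u, v, w} A B) (x y : X) :
    X.innerL x y = X.inner x y := rfl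

@[simp] theorem ractL_apply (X : CStarCorr.{u, v, w} A B) (x : X) (b : B) :
    X.ractL x b = X.ract x b := rfl

@[simp] theorem lactL_apply (X : CStarCorr.{u, v, w} A B) (a : A) (x : X) :
    X.lactL a x = X.lact a x := rfl

theorem Hom.norm_map {X : CStarCorr.{u, v, w} A B} {Y : CStarCorr.{u, v, w'} A B} (f : Hom X Y)
    (x : X) : ‖f x‖ = ‖x‖ := by
  rw [← sq_eq_sq₀ (norm_nonneg _) (norm_nonneg _), X.norm_sq, Y.norm_sq]
  exact congrArg _ (f.map_inner x x)

/-- A map of correspondences is isometric. -/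
def Hom.toIsometry {X : CStarCorr.{u, v, w} A B} {Y : CStarCorr.{u, v, w'} A B} (f : Hom X Y) :
    X.carrier →ₗᵢ[ℂ] Y.carrier where
  toLinearMap := f.toLinearMap
  norm_map' := f.norm_map

theorem Hom.ext' {X : CStarCorr.{u, v, w} A B} {Y : CStarCorr.{u, v, w'} A B} {f g : Hom X Y}
    (h : ∀ x, f x = g x) : f = g := by
  obtain ⟨f, _, _, _⟩ := f
  obtain ⟨g, _, _, _⟩ := g
  obtain rfl : f = g := LinearMap.ext h
  rfl

/-- A map of correspondences is an isomorphism as soon as its values span a dense subspace. -/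
theorem Hom.isIso_of_dense {X : CStarCorr.{u, v, w} A B} {Y : CStarCorr.{u, v, w'} A B}
    (f : Hom X Y) (s : Set Y.carrier) (hs : (Submodule.span ℂ s).topologicalClosure = ⊤)
    (h : ∀ y ∈ s, ∃ x, f x = y) : f.IsIso := by
  refine ⟨f.toIsometry.injective, fun y => ?_⟩
  -- The isometric image of a complete space is closed, so density of the range suffices for
  -- surjectivity.
  have hc : IsClosed (f.toLinearMap.range : Set Y.carrier) := by
    have : (f.toLinearMap.range : Set Y.carrier) = Set.range f.toIsometry := rfl
    rw [this]
    exact f.toIsometry.isometry.isClosedEmbedding.isClosed_range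
  have h1 : (Submodule.span ℂ s).topologicalClosure ≤ f.toLinearMap.range :=
    Submodule.topologicalClosure_minimal _ (Submodule.span_le.2 h) hc
  rw [hs] at h1
  exact h1 (Submodule.mem_top (x := y))

end CStarCorr

/-! ### Extending linear and bilinear maps to Hausdorff completions -/

namespace PreCStarCorr

variable {A : Type u} {B : Type v} [NonUnitalCStarAlgebra A] [NonUnitalCStarAlgebra B]

theorem norm_map_of_inner (V : PreCStarCorr.{u, v, w} A B) (Z : CStarCorr.{u, v, w'} A B)
    (f : V.carrier →ₗ[ℂ] Z.carrier) (hf : ∀ x y, Z.inner (f x) (f y) = V.inner x y)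
    (x : V.carrier) : ‖f x‖ = ‖x‖ := by
  rw [← sq_eq_sq₀ (norm_nonneg _) (norm_nonneg _), Z.norm_sq, V.norm_sq, hf]

/-- The extension to the completion of a linear map which preserves inner products. -/
noncomputable def extendL (V : PreCStarCorr.{u, v, w} A B) (Z : CStarCorr.{u, v, w'} A B)
    (f : V.carrier →ₗ[ℂ] Z.carrier) (hf : ∀ x y, Z.inner (f x) (f y) = V.inner x y) :
    V.Compl →L[ℂ] Z.carrier :=
  (f.mkContinuous 1 fun x => by
    rw [V.norm_map_of_inner Z f hf, one_mul]).extend V.toCompl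

theorem extendL_toCompl (V : PreCStarCorr.{u, v, w} A B) (Z : CStarCorr.{u, v, w'} A B)
    (f : V.carrier →ₗ[ℂ] Z.carrier) (hf : ∀ x y, Z.inner (f x) (f y) = V.inner x y)
    (x : V.carrier) : V.extendL Z f hf (V.toCompl x) = f x :=
  ContinuousLinearMap.extend_eq _ V.denseRange_toCompl V.isUniformInducing_toCompl x

theorem span_toCompl_dense (V : PreCStarCorr.{u, v, w} A B) {s : Set V.carrier}
    (hs : Submodule.span ℂ s = ⊤) :
    (Submodule.span ℂ {z : V.completion.carrier | ∃ x ∈ s, V.toCompl x = z}).topologicalClosure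
      = ⊤ := by
  let T : V.carrier →ₗ[ℂ] V.completion.carrier := V.toCompl.toLinearMap
  have hd : Dense (Set.range T) := V.denseRange_toCompl
  refine Submodule.dense_iff_topologicalClosure_eq_top.1 (hd.mono ?_)
  rintro _ ⟨t, rfl⟩
  have ht : t ∈ Submodule.span ℂ s := hs ▸ Submodule.mem_top
  have h2 := Submodule.mem_map_of_mem (f := T) ht
  rw [Submodule.map_span] at h2
  exact h2

/-- Both sides are sesquilinear, so the two variables can be reduced to generators one after the
other. The span is algebraic and no continuity enters. -/
theorem map_inner_of_span (V : PreCStarCorr.{u, v, w} A B) (Z : CStarCorr.{u, v, w'} A B)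
    (f : V.carrier →ₗ[ℂ] Z.carrier) {s : Set V.carrier} (hs : Submodule.span ℂ s = ⊤)
    (hf : ∀ x ∈ s, ∀ y ∈ s, Z.inner (f x) (f y) = V.inner x y) (x y : V.carrier) :
    Z.inner (f x) (f y) = V.inner x y := by
  have h1 : ∀ x ∈ s, ∀ y, Z.inner (f x) (f y) = V.inner x y := fun x hx y =>
    LinearMap.congr_fun (LinearMap.ext_on (f := Z.inner (f x) ∘ₗ f) (g := V.inner x) hs
      (fun y hy => hf x hx y hy)) y
  exact LinearMap.congr_fun (LinearMap.ext_on
    (f := (Z.inner.flip (f y)).comp f) (g := V.inner.flip y) hs (fun x hx => h1 x hx y)) x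

theorem map_lact_of_span (V : PreCStarCorr.{u, v, w} A B) (Z : CStarCorr.{u, v, w'} A B)
    (f : V.carrier →ₗ[ℂ] Z.carrier) {s : Set V.carrier} (hs : Submodule.span ℂ s = ⊤)
    (hl : ∀ a, ∀ x ∈ s, f (V.lact a x) = Z.lact a (f x)) (a : A) (x : V.carrier) :
    f (V.lact a x) = Z.lact a (f x) :=
  LinearMap.congr_fun (LinearMap.ext_on (f := f ∘ₗ V.lact a)
    (g := (Z.lact a).toLinearMap ∘ₗ f) hs (fun x hx => hl a x hx)) x

/-- The map of correspondences on the completion induced by a linear map which preserves inner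
products and left actions. -/
noncomputable def completionLift (V : PreCStarCorr.{u, v, w} A B) (Z : CStarCorr.{u, v, w'} A B)
    (f : V.carrier →ₗ[ℂ] Z.carrier) (hf : ∀ x y, Z.inner (f x) (f y) = V.inner x y)
    (hl : ∀ a x, f (V.lact a x) = Z.lact a (f x)) : CStarCorr.Hom V.completion Z where
  toLinearMap := (V.extendL Z f hf).toLinearMap
  map_inner x y := by
    change Z.innerL (V.extendL Z f hf x) (V.extendL Z f hf y) = V.complInner x y
    refine V.denseRange_toCompl.induction_on₂ (isClosed_eq (by fun_prop) (by fun_prop)) ?_ x y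
    intro x y
    rw [extendL_toCompl, extendL_toCompl, complInner_coe, CStarCorr.innerL_apply, hf]
  map_ract x b := by
    change V.extendL Z f hf (V.complRact x b) = Z.ractL (V.extendL Z f hf x) b
    refine V.denseRange_toCompl.induction_on x (isClosed_eq (by fun_prop) (by fun_prop)) ?_
    intro x
    rw [complRact_coe, extendL_toCompl, extendL_toCompl, CStarCorr.ractL_apply]
    -- Compatibility with the right action is automatic: expanding `‖f(xb) - f(x)b‖²` gives four
    -- terms `±b⋆⟨x, x⟩b`, which cancel.
    rw [← sub_eq_zero, ← norm_eq_zero, ← pow_eq_zero_iff two_ne_zero, Z.norm_sq]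
    simp only [map_sub, LinearMap.sub_apply, Z.inner_ract, Z.inner_ract_left, hf, V.inner_ract,
      V.inner_ract_left, mul_assoc, sub_self, norm_zero]
  map_lact a x := by
    change V.extendL Z f hf (V.complLact a x) = Z.lactL a (V.extendL Z f hf x)
    refine V.denseRange_toCompl.induction_on x (isClosed_eq (by fun_prop) (by fun_prop)) ?_
    intro x
    rw [complLact_coe, extendL_toCompl, extendL_toCompl, CStarCorr.lactL_apply, hl]

theorem completionLift_toCompl (V : PreCStarCorr.{u, v, w} A B) (Z : CStarCorr.{u, v, w'} A B)
    (f : V.carrier →ₗ[ℂ] Z.carrier) (hf : ∀ x y, Z.inner (f x) (f y) = V.inner x y)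
    (hl : ∀ a x, f (V.lact a x) = Z.lact a (f x)) (x : V.carrier) :
    V.completionLift Z f hf hl (V.toCompl x) = f x :=
  V.extendL_toCompl Z f hf x

section Bilinear

variable {C : Type x} [NonUnitalCStarAlgebra C] (V : PreCStarCorr.{u, v, w} A B)
  (W : PreCStarCorr.{v, x, w'} B C) (Z : CStarCorr.{u, x, w₁} A C)
  (b : V.carrier →ₗ[ℂ] W.carrier →ₗ[ℂ] Z.carrier)

/-- Both sides are conjugate linear in `x`, `y` and linear in `x'`, `y'`, so span induction applies
to the four variables in turn. -/
theorem bilin_inner_of_span {s : Set V.carrier} (hs : Submodule.span ℂ s = ⊤)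
    {t : Set W.carrier} (ht : Submodule.span ℂ t = ⊤)
    (hb : ∀ x ∈ s, ∀ x' ∈ s, ∀ y ∈ t, ∀ y' ∈ t,
      Z.inner (b x y) (b x' y') = W.inner y (W.lact (V.inner x x') y'))
    (x x' : V.carrier) (y y' : W.carrier) :
    Z.inner (b x y) (b x' y') = W.inner y (W.lact (V.inner x x') y') := by
  have hx : x ∈ Submodule.span ℂ s := hs ▸ Submodule.mem_top
  have hx' : x' ∈ Submodule.span ℂ s := hs ▸ Submodule.mem_top
  have hy : y ∈ Submodule.span ℂ t := ht ▸ Submodule.mem_top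
  have hy' : y' ∈ Submodule.span ℂ t := ht ▸ Submodule.mem_top
  induction hx using Submodule.span_induction with
  | zero => simp
  | add x₁ x₂ _ _ h₁ h₂ => simp only [map_add, LinearMap.add_apply, h₁, h₂]
  | smul c x₁ _ h₁ => simp only [map_smulₛₗ, LinearMap.smul_apply, h₁]; simp
  | mem x hx =>
  induction hx' using Submodule.span_induction with
  | zero => simp
  | add x₁ x₂ _ _ h₁ h₂ => simp only [map_add, LinearMap.add_apply, h₁, h₂]
  | smul c x₁ _ h₁ => simp only [map_smul, LinearMap.smul_apply, h₁]
  | mem x' hx' =>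
  induction hy using Submodule.span_induction with
  | zero => simp
  | add x₁ x₂ _ _ h₁ h₂ => simp only [map_add, LinearMap.add_apply, h₁, h₂]
  | smul c x₁ _ h₁ => simp only [map_smulₛₗ, LinearMap.smul_apply, h₁]; simp
  | mem y hy =>
  induction hy' using Submodule.span_induction with
  | zero => simp
  | add x₁ x₂ _ _ h₁ h₂ => simp only [map_add, h₁, h₂]
  | smul c x₁ _ h₁ => simp only [map_smul, h₁]
  | mem y' hy' => exact hb x hx x' hx' y hy y' hy'

theorem completion_inner_lact_toCompl (x x' : V.carrier) (y y' : W.carrier) :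
    W.completion.inner (W.toCompl y) (W.completion.lact
      (V.completion.inner (V.toCompl x) (V.toCompl x')) (W.toCompl y'))
        = W.inner y (W.lact (V.inner x x') y') := by
  rw [completion_inner_toCompl, completion_lact_toCompl, completion_inner_toCompl]

/-- The inner product identity supplies its own bound: `‖b x y‖² = ‖⟨y, ⟨x, x⟩ · y⟩‖ ≤ ‖x‖² ‖y‖²`.
Hence `b` extends by continuity, and the identity extends with it by density. -/
theorem exists_completionBilin
    (hb : ∀ x x' y y', Z.inner (b x y) (b x' y') = W.inner y (W.lact (V.inner x x') y')) :
    ∃ M : V.completion.carrier →L[ℂ] W.completion.carrier →L[ℂ] Z.carrier,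
      (∀ x y, M (V.toCompl x) (W.toCompl y) = b x y) ∧
      ∀ x x' y y', Z.inner (M x y) (M x' y')
        = W.completion.inner y (W.completion.lact (V.completion.inner x x') y') := by
  let b₁ : V.carrier →L[ℂ] W.carrier →L[ℂ] Z.carrier := LinearMap.mkContinuous₂ b 1 fun x y => by
    refine le_of_sq_le_sq ?_ (by positivity)
    rw [Z.norm_sq, hb, one_mul]
    calc ‖W.inner y (W.lact (V.inner x x) y)‖ ≤ ‖y‖ * (‖V.inner x x‖ * ‖y‖) := by
          have h1 := W.innerL.le_of_opNorm₂_le_of_le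
            (LinearMap.mkContinuous₂_norm_le _ zero_le_one _)
            (le_refl ‖y‖) (le_refl ‖W.lact (V.inner x x) y‖)
          have h2 := W.lactL.le_of_opNorm₂_le_of_le
            (LinearMap.mkContinuous₂_norm_le _ zero_le_one _)
            (le_refl ‖V.inner x x‖) (le_refl ‖y‖)
          rw [one_mul] at h1 h2
          exact h1.trans (by gcongr; exact h2)
      _ = (‖x‖ * ‖y‖) ^ 2 := by rw [← V.norm_sq]; ring
  -- The extension is made in one variable at a time; the flips expose the second variable and then
  -- restore the order.
  let M : V.Compl →L[ℂ] W.Compl →L[ℂ] Z.carrier :=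
    ((b₁.extend V.toCompl).flip.extend W.toCompl).flip
  have hM : ∀ x y, M (V.toCompl x) (W.toCompl y) = b x y := fun x y => by
    simp only [M]
    rw [ContinuousLinearMap.flip_apply,
      ContinuousLinearMap.extend_eq _ W.denseRange_toCompl W.isUniformInducing_toCompl,
      ContinuousLinearMap.flip_apply,
      ContinuousLinearMap.extend_eq _ V.denseRange_toCompl V.isUniformInducing_toCompl]
    rfl
  refine ⟨M, hM, fun x x' y y' => ?_⟩
  change Z.innerL (M x y) (M x' y') = W.complInner y (W.complLact (V.complInner x x') y')
  refine V.denseRange_toCompl.induction_on₂ (isClosed_eq (by fun_prop) (by fun_prop)) ?_ x x'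
  intro x x'
  refine W.denseRange_toCompl.induction_on₂ (isClosed_eq (by fun_prop) (by fun_prop)) ?_ y y'
  intro y y'
  rw [hM, hM, complInner_coe, complLact_coe, complInner_coe, CStarCorr.innerL_apply, hb]

end Bilinear

end PreCStarCorr

/-! ### Universal properties of balanced tensor products and direct sums -/

namespace CStarCorr

variable {A : Type u} {B : Type v} {C : Type x} [NonUnitalCStarAlgebra A]
  [NonUnitalCStarAlgebra B] [NonUnitalCStarAlgebra C]

section Tensor

variable (X : CStarCorr.{u, v, w} A B) (Y : CStarCorr.{v, x, w'} B C)

theorem inner_tmul (x x' : X) (y y' : Y) :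
    (X.tensor Y).inner (X.tmul Y x y) (X.tmul Y x' y') = Y.inner y (Y.lact (X.inner x x') y') :=
  (preTensor X Y).complInner_coe _ _

/-- The elementary tensors as a continuous bilinear map. -/
noncomputable def tmulL : X →L[ℂ] Y →L[ℂ] (X.tensor Y).carrier :=
  LinearMap.mkContinuous₂ ((TensorProduct.mk ℂ X.carrier Y.carrier).compr₂
    (preTensor X Y).toCompl.toLinearMap) 1 fun x y => by
    refine le_of_sq_le_sq ?_ (by positivity)
    change ‖X.tmul Y x y‖ ^ 2 ≤ _
    rw [(X.tensor Y).norm_sq, inner_tmul, one_mul]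
    calc ‖Y.inner y (Y.lact (X.inner x x) y)‖ ≤ ‖y‖ * (‖X.inner x x‖ * ‖y‖) :=
          (Y.norm_inner_le _ _).trans (by gcongr; exact Y.norm_lact_le _ _)
      _ = (‖x‖ * ‖y‖) ^ 2 := by rw [← X.norm_sq]; ring

theorem span_preTensor :
    Submodule.span ℂ {t : (preTensor X Y).carrier | ∃ (x : X) (y : Y), x ⊗ₜ[ℂ] y = t} = ⊤ :=
  TensorProduct.span_tmul_eq_top ℂ X.carrier Y.carrier

theorem span_tmul_dense :
    (Submodule.span ℂ {z : X.tensor Y | ∃ x y, X.tmul Y x y = z}).topologicalClosure = ⊤ := by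
  refine Eq.trans ?_ ((preTensor X Y).span_toCompl_dense (span_preTensor X Y))
  congr 2
  ext z
  constructor
  · rintro ⟨x, y, rfl⟩
    exact ⟨_, ⟨x, y, rfl⟩, rfl⟩
  · rintro ⟨_, ⟨x, y, rfl⟩, rfl⟩
    exact ⟨x, y, rfl⟩

variable {X Y}

/-- The map of correspondences on `X ⊗_B Y` induced by a bilinear map. -/
noncomputable def tensorLift (Z : CStarCorr.{u, x, w₁} A C)
    (M : X.carrier →ₗ[ℂ] Y.carrier →ₗ[ℂ] Z.carrier)
    (hM : ∀ x y x' y', Z.inner (M x y) (M x' y') = Y.inner y (Y.lact (X.inner x x') y'))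
    (hl : ∀ a x y, M (X.lact a x) y = Z.lact a (M x y)) : Hom (X.tensor Y) Z :=
  (preTensor X Y).completionLift Z (TensorProduct.lift M)
    ((preTensor X Y).map_inner_of_span Z _ (span_preTensor X Y) (by
      rintro _ ⟨x, y, rfl⟩ _ ⟨x', y', rfl⟩
      exact hM x y x' y'))
    ((preTensor X Y).map_lact_of_span Z _ (span_preTensor X Y) (by
      rintro a _ ⟨x, y, rfl⟩
      exact hl a x y))

theorem tensorLift_tmul (Z : CStarCorr.{u, x, w₁} A C)
    (M : X.carrier →ₗ[ℂ] Y.carrier →ₗ[ℂ] Z.carrier)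
    (hM : ∀ x y x' y', Z.inner (M x y) (M x' y') = Y.inner y (Y.lact (X.inner x x') y'))
    (hl : ∀ a x y, M (X.lact a x) y = Z.lact a (M x y)) (x : X) (y : Y) :
    tensorLift Z M hM hl (X.tmul Y x y) = M x y := by
  refine ((preTensor X Y).completionLift_toCompl Z _ _ _ _).trans ?_
  exact TensorProduct.lift.tmul x y

end Tensor

section DirectSum

variable {ι : Type w'} (X : ι → CStarCorr.{u, v, w} A B)

open scoped Classical in
theorem inner_directSumIncl_self (i : ι) (x y : X i) :
    (directSum X).inner (directSumIncl X i x) (directSumIncl X i y) = (X i).inner x y := by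
  refine ((preDirectSum X).complInner_coe _ _).trans ?_
  refine (finsum_eq_single _ i fun j hj => ?_).trans ?_
  · simp [DFinsupp.single_eq_of_ne hj]
  · simp

open scoped Classical in
theorem inner_directSumIncl_of_ne {i j : ι} (h : i ≠ j) (x : X i) (y : X j) :
    (directSum X).inner (directSumIncl X i x) (directSumIncl X j y) = 0 := by
  refine ((preDirectSum X).complInner_coe _ _).trans ?_
  refine finsum_eq_zero_of_forall_eq_zero fun l => ?_
  by_cases hl : l = i
  · subst hl
    simp [DFinsupp.single_eq_of_ne h]
  · simp [DFinsupp.single_eq_of_ne hl]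

open scoped Classical in
theorem lact_directSumIncl (i : ι) (a : A) (x : X i) :
    (directSum X).lact a (directSumIncl X i x) = directSumIncl X i ((X i).lact a x) := by
  refine ((preDirectSum X).complLact_coe _ _).trans ?_
  exact congrArg (preDirectSum X).toCompl
    (DFinsupp.mapRange_single (f := fun i z => (X i).lact a z) (hf := by simp))

open scoped Classical in
theorem ract_directSumIncl (i : ι) (x : X i) (b : B) :
    (directSum X).ract (directSumIncl X i x) b = directSumIncl X i ((X i).ract x b) := by
  refine ((preDirectSum X).complRact_coe _ _).trans ?_
  exact congrArg (preDirectSum X).toCompl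
    (DFinsupp.mapRange_single (f := fun i z => (X i).ract z b) (hf := by simp))

open scoped Classical in
/-- The inclusion of a summand as a linear isometry. -/
noncomputable def directSumInclL (i : ι) : (X i).carrier →ₗᵢ[ℂ] (directSum X).carrier where
  toLinearMap := (preDirectSum X).toCompl.toLinearMap ∘ₗ
    DFinsupp.lsingle (M := fun i => (X i).carrier) i
  norm_map' x := by
    rw [← sq_eq_sq₀ (norm_nonneg _) (norm_nonneg _), HilbertModule.norm_sq,
      HilbertModule.norm_sq]
    exact congrArg _ (inner_directSumIncl_self X i x x)

open scoped Classical in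
theorem span_preDirectSum :
    Submodule.span ℂ {t : (preDirectSum X).carrier |
      ∃ i x, (DFinsupp.single i x : Π₀ i, (X i).carrier) = t} = ⊤ := by
  refine Submodule.eq_top_iff'.2 fun t => ?_
  have h : ∀ t : Π₀ i, (X i).carrier, t ∈ Submodule.span ℂ {t : Π₀ i, (X i).carrier |
      ∃ i x, DFinsupp.single i x = t} := fun t => by
    induction t using DFinsupp.induction with
    | h0 => exact Submodule.zero_mem _
    | ha i x f _ _ ih => exact Submodule.add_mem _ (Submodule.subset_span ⟨i, x, rfl⟩) ih
  exact h t

theorem span_directSumIncl_dense :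
    (Submodule.span ℂ {z : directSum X | ∃ i x, directSumIncl X i x = z}).topologicalClosure
      = ⊤ := by
  refine Eq.trans ?_ ((preDirectSum X).span_toCompl_dense (span_preDirectSum X))
  congr 2
  ext z
  constructor
  · rintro ⟨i, x, rfl⟩
    exact ⟨_, ⟨i, x, rfl⟩, rfl⟩
  · rintro ⟨_, ⟨i, x, rfl⟩, rfl⟩
    exact ⟨i, x, rfl⟩

/-- One term of a sum of positive elements is at most the sum, and the norm is monotone on positive
elements. This bounds the coordinate maps, which therefore extend to the completed direct sum. -/
theorem norm_apply_le (x : Π₀ i, (X i).carrier) (i : ι) :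
    ‖x i‖ ≤ ‖(show (preDirectSum X).carrier from x)‖ := by
  let _ := CStarAlgebra.spectralOrder B
  have := CStarAlgebra.spectralOrderedRing B
  refine le_of_sq_le_sq ?_ (by positivity)
  rw [HilbertModule.norm_sq, PreCStarCorr.norm_sq]
  refine CStarAlgebra.norm_le_norm_of_nonneg_of_le
    ((isCStarPositive_iff _).1 ((X i).inner_self_pos _)) ?_
  change _ ≤ ∑ᶠ i, (X i).inner (x i) (x i)
  exact single_le_finsum i (finite_support_inner X x x)
    fun j => (isCStarPositive_iff _).1 ((X j).inner_self_pos _)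

/-- The projection of a direct sum onto a summand. -/
noncomputable def directSumProj (i : ι) : (directSum X).carrier →L[ℂ] (X i).carrier :=
  ((DFinsupp.lapply (M := fun i => (X i).carrier) (R := ℂ) i : _ →ₗ[ℂ] _).mkContinuous
    (E := (preDirectSum X).carrier) 1 fun x => by
      rw [one_mul]; exact norm_apply_le X x i).extend (preDirectSum X).toCompl

open scoped Classical in
theorem directSumProj_incl_self (i : ι) (x : X i) :
    directSumProj X i (directSumIncl X i x) = x := by
  refine (ContinuousLinearMap.extend_eq _ (preDirectSum X).denseRange_toCompl
    (preDirectSum X).isUniformInducing_toCompl _).trans ?_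
  exact DFinsupp.single_eq_same (β := fun i => (X i).carrier)

open scoped Classical in
theorem directSumProj_incl_of_ne {i j : ι} (h : i ≠ j) (x : X j) :
    directSumProj X i (directSumIncl X j x) = 0 := by
  refine (ContinuousLinearMap.extend_eq _ (preDirectSum X).denseRange_toCompl
    (preDirectSum X).isUniformInducing_toCompl _).trans ?_
  exact DFinsupp.single_eq_of_ne (β := fun i => (X i).carrier) h

open scoped Classical in
/-- The map of correspondences on a direct sum induced by maps on the summands. -/
theorem exists_directSumLift (Z : CStarCorr.{u, v, w₁} A B)
    (f : ∀ i, (X i).carrier →ₗ[ℂ] Z.carrier)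
    (hf : ∀ i x y, Z.inner (f i x) (f i y) = (X i).inner x y)
    (hne : ∀ i j x y, i ≠ j → Z.inner (f i x) (f j y) = 0)
    (hl : ∀ i a x, f i ((X i).lact a x) = Z.lact a (f i x)) :
    ∃ F : Hom (directSum X) Z, ∀ i x, F (directSumIncl X i x) = f i x := by
  let g : (Π₀ i, (X i).carrier) →ₗ[ℂ] Z.carrier := DFinsupp.lsum ℂ f
  have hg : ∀ i x, g (DFinsupp.single i x) = f i x := fun i x => by simp [g]
  refine ⟨(preDirectSum X).completionLift Z g
    ((preDirectSum X).map_inner_of_span Z g (span_preDirectSum X) ?_)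
    ((preDirectSum X).map_lact_of_span Z g (span_preDirectSum X) ?_), fun i x => ?_⟩
  · rintro _ ⟨i, x, rfl⟩ _ ⟨j, y, rfl⟩
    refine (congrArg₂ (fun s t => Z.inner s t) (hg i x) (hg j y)).trans ?_
    -- Read in the completion, the right side is an inner product of two inclusions, for which the
    -- formulas are known.
    refine Eq.trans ?_ ((preDirectSum X).completion_inner_toCompl _ _)
    by_cases hij : i = j
    · subst hij
      exact (hf i x y).trans (inner_directSumIncl_self X i x y).symm
    · exact (hne i j x y hij).trans (inner_directSumIncl_of_ne X hij x y).symm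
  · rintro a _ ⟨i, x, rfl⟩
    refine Eq.trans ?_ (congrArg (Z.lact a) (hg i x)).symm
    rw [← hl, ← hg]
    exact congrArg g (DFinsupp.mapRange_single (f := fun i z => (X i).lact a z) (hf := by simp))
  · exact ((preDirectSum X).completionLift_toCompl Z _ _ _ _).trans (hg i x)

open scoped Classical in
/-- The bilinear map on direct sums induced by bilinear maps on the summands. -/
theorem exists_directSumBilin {κ : Type*} (X' : κ → CStarCorr.{v, x, w₁} B C)
    (Z : CStarCorr A C) (b : ∀ i j, (X i).carrier →ₗ[ℂ] (X' j).carrier →ₗ[ℂ] Z.carrier)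
    (hb : ∀ i i' j j' x x' y y', Z.inner (b i j x y) (b i' j' x' y')
      = (directSum X').inner (directSumIncl X' j y) ((directSum X').lact
        ((directSum X).inner (directSumIncl X i x) (directSumIncl X i' x'))
          (directSumIncl X' j' y'))) :
    ∃ M : (directSum X).carrier →L[ℂ] (directSum X').carrier →L[ℂ] Z.carrier,
      (∀ i j x y, M (directSumIncl X i x) (directSumIncl X' j y) = b i j x y) ∧
      ∀ x x' y y', Z.inner (M x y) (M x' y')
        = (directSum X').inner y ((directSum X').lact ((directSum X).inner x x') y') := by
  let b₀ : (Π₀ i, (X i).carrier) →ₗ[ℂ] (Π₀ j, (X' j).carrier) →ₗ[ℂ] Z.carrier :=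
    DFinsupp.lsum ℂ fun i => (DFinsupp.lsum ℂ fun j => (b i j).flip).flip
  have h₀ : ∀ i j x y, b₀ (DFinsupp.single i x) (DFinsupp.single j y) = b i j x y := by
    intro i j x y
    simp [b₀]
  obtain ⟨M, hM, hM'⟩ := (preDirectSum X).exists_completionBilin (preDirectSum X') Z b₀
    ((preDirectSum X).bilin_inner_of_span (preDirectSum X') Z b₀ (span_preDirectSum X)
      (span_preDirectSum X') (by
        rintro _ ⟨i, x, rfl⟩ _ ⟨i', x', rfl⟩ _ ⟨j, y, rfl⟩ _ ⟨j', y', rfl⟩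
        refine (congrArg₂ (fun s t => Z.inner s t) (h₀ i j x y) (h₀ i' j' x' y')).trans ?_
        exact (hb i i' j j' x x' y y').trans ((preDirectSum X).completion_inner_lact_toCompl
          (preDirectSum X') _ _ _ _)))
  exact ⟨M, fun i j x y => (hM _ _).trans (h₀ i j x y), hM'⟩

end DirectSum

end CStarCorr

namespace CStarCorr

variable {A : Type u} {B : Type v} {C : Type x} [NonUnitalCStarAlgebra A]
  [NonUnitalCStarAlgebra B] [NonUnitalCStarAlgebra C]

theorem lact_tmul (X : CStarCorr.{u, v, w} A B) (Y : CStarCorr.{v, x, w'} B C) (b : A) (x : X)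
    (y : Y) : (X.tensor Y).lact b (X.tmul Y x y) = X.tmul Y (X.lact b x) y :=
  (preTensor X Y).completion_lact_toCompl _ _

theorem Hom.isIso_ident_of_dense {X : CStarCorr.{u, u, w} A A} (f : Hom X (ident A)) (s : Set A)
    (hs : (Submodule.span ℂ s).topologicalClosure = ⊤) (h : ∀ y ∈ s, ∃ x, f x = y) : f.IsIso :=
  f.isIso_of_dense s hs h

theorem ident_inner (x y : A) : (ident A).inner x y = star x * y := rfl

theorem ident_lact (b x : A) : (ident A).lact b x = b * x := rfl

end CStarCorr

/-! ### Elements of the `c₀`-sum supported at one vertex -/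

namespace C0Sum

open scoped ENNReal

variable {V : Type w} {A : V → Type u} [∀ v, NonUnitalCStarAlgebra (A v)]

theorem single_apply_self (v : V) (a : A v) : (single A v a).1 v = a := by
  classical
  exact lp.single_apply_self ∞ v a

theorem single_apply_of_ne {v v' : V} (h : v' ≠ v) (a : A v) : (single A v a).1 v' = 0 := by
  classical
  exact lp.single_apply_ne ∞ v a h

theorem mul_single (v : V) (a : A v) (b : C0Sum A) :
    b * single A v a = single A v (b.1 v * a) := by
  rw [← star_inj, star_mul, star_single, star_single, ← single_mul, star_mul]
  rfl

theorem star_single_mul_single (v : V) (a b : A v) :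
    star (single A v a) * single A v b = single A v (star a * b) := by
  rw [star_single, ← single_mul, single_apply_self]

theorem star_single_mul_single_of_ne {v v' : V} (h : v' ≠ v) (a : A v) (b : A v') :
    star (single A v a) * single A v' b = 0 := by
  rw [star_single, ← single_mul, single_apply_of_ne h.symm, mul_zero, map_zero]

/-- Since `‖b_v‖ → 0`, only finitely many coordinates have norm at least `ε / 2`. Truncating `b` to
these leaves an error of supremum norm at most `ε / 2`. -/
theorem span_single_dense :
    (Submodule.span ℂ {b : C0Sum A | ∃ v a, single A v a = b}).topologicalClosure = ⊤ := by
  classical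
  refine Submodule.eq_top_iff'.2 fun b => ?_
  refine Metric.mem_closure_iff.2 fun ε hε => ?_
  have hb : Filter.Tendsto (fun v => ‖b.1 v‖) Filter.cofinite (nhds 0) := b.2
  have hfin : {v | ¬ ‖b.1 v‖ < ε / 2}.Finite :=
    Filter.eventually_cofinite.1 (hb.eventually (gt_mem_nhds (half_pos hε)))
  refine ⟨∑ v ∈ hfin.toFinset, single A v (b.1 v),
    Submodule.sum_mem _ fun v _ => Submodule.subset_span ⟨v, _, rfl⟩, ?_⟩
  rw [dist_eq_norm]
  -- Coordinatewise bounds give only a weak inequality for the supremum; the threshold `ε / 2` makes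
  -- it strict.
  refine lt_of_le_of_lt ?_ (half_lt_self hε)
  refine lp.norm_le_of_forall_le (half_pos hε).le fun v => ?_
  have hsum : (∑ v ∈ hfin.toFinset, single A v (b.1 v)).1 v
      = ∑ v' ∈ hfin.toFinset, (single A v' (b.1 v')).1 v := by
    rw [AddSubmonoidClass.coe_finsetSum, lp.coeFn_sum, Finset.sum_apply]
  change ‖b.1 v - (∑ v ∈ hfin.toFinset, single A v (b.1 v)).1 v‖ ≤ ε / 2
  rw [hsum]
  by_cases hv : v ∈ hfin.toFinset
  · rw [Finset.sum_eq_single_of_mem v hv fun v' _ h => single_apply_of_ne h.symm _,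
      single_apply_self, sub_self, norm_zero]
    exact (half_pos hε).le
  · rw [Finset.sum_eq_zero fun v' hv' => single_apply_of_ne
      (fun h : v = v' => hv (h ▸ hv')) _, sub_zero]
    simpa using (not_not.1 (fun h => hv (hfin.mem_toFinset.2 h))).le

end C0Sum

/-! ### Consequences of unique factorisation -/

namespace KGraph

variable {k : ℕ} {Λ : Type u} [CategoryTheory.Category.{v} Λ] (D : KGraph k Λ)

/-- The path of degree zero at a vertex. -/
abbrev idPath (b : Λ) : D.Path 0 := ⟨b, b, 𝟙 b, D.degree_id b⟩

/-- A morphism `f` of degree `0 = 0 + 0` factors both as `f` times the identity of its source and as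
the identity of its range times `f`. Uniqueness identifies the two factorisations. -/
theorem exists_eq_idPath (p : D.Path 0) : ∃ b, p = D.idPath b := by
  obtain ⟨s, r, f, hf⟩ := p
  have h := (D.factorisation f 0 0 (by simpa using hf)).unique
    (y₁ := ⟨s, f, 𝟙 s⟩) (y₂ := ⟨r, 𝟙 r, f⟩)
    ⟨hf, D.degree_id s, CategoryTheory.Category.id_comp f⟩
    ⟨D.degree_id r, hf, CategoryTheory.Category.comp_id f⟩
  obtain rfl : s = r := congrArg Sigma.fst h
  have h2 := congrArg Prod.fst (eq_of_heq (Sigma.mk.inj h).2)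
  dsimp only at h2
  subst h2
  exact ⟨s, rfl⟩

/-- Paths of a product are determined by the product and their degrees. -/
theorem path_comp_injective {m n : Fin k → ℕ} {t v r t' v' r' : Λ} {α : v ⟶ r} {β : t ⟶ v}
    {α' : v' ⟶ r'} {β' : t' ⟶ v'} (hα : D.degree α = m) (hβ : D.degree β = n)
    (hα' : D.degree α' = m) (hβ' : D.degree β' = n) {h h'}
    (e : (⟨t, r, β ≫ α, h⟩ : D.Path (m + n)) = ⟨t', r', β' ≫ α', h'⟩) :
    (⟨v, r, α, hα⟩ : D.Path m) = ⟨v', r', α', hα'⟩ ∧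
      (⟨t, v, β, hβ⟩ : D.Path n) = ⟨t', v', β', hβ'⟩ := by
  obtain rfl : t = t' := congrArg Path.src e
  obtain rfl : r = r' := congrArg Path.rng e
  have e' : β ≫ α = β' ≫ α' := by simpa using e
  have hu := (D.factorisation (β ≫ α) m n h).unique
    (y₁ := ⟨v, α, β⟩) (y₂ := ⟨v', α', β'⟩) ⟨hα, hβ, rfl⟩ ⟨hα', hβ', e'.symm⟩
  obtain rfl : v = v' := congrArg Sigma.fst hu
  have h2 := Prod.mk.inj (eq_of_heq (Sigma.mk.inj hu).2)
  obtain ⟨rfl, rfl⟩ := h2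
  exact ⟨rfl, rfl⟩

end KGraph

/-! ### The fibres and their generators -/

namespace LambdaSystem

variable {k : ℕ} {Λ : Type u} [CategoryTheory.Category.{v} Λ] {D : KGraph k Λ}
  (S : LambdaSystem.{u, v, w, a} D)

theorem inner_incl_self {n : Fin k → ℕ} {s r : Λ} (f : s ⟶ r) (hf : D.degree f = n)
    (x y : S.X f) : (S.fibre n).inner (S.incl f hf x) (S.incl f hf y)
      = C0Sum.single S.A s ((S.X f).inner x y) :=
  CStarCorr.inner_directSumIncl_self (fun p : D.Path n => (S.X p.hom).inflate) ⟨s, r, f, hf⟩ x y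

theorem inner_incl_of_ne {n : Fin k → ℕ} {s r s' r' : Λ} (f : s ⟶ r) (hf : D.degree f = n)
    (g : s' ⟶ r') (hg : D.degree g = n)
    (h : (⟨s, r, f, hf⟩ : D.Path n) ≠ ⟨s', r', g, hg⟩) (x : S.X f) (y : S.X g) :
    (S.fibre n).inner (S.incl f hf x) (S.incl g hg y) = 0 :=
  CStarCorr.inner_directSumIncl_of_ne (fun p : D.Path n => (S.X p.hom).inflate) h x y

theorem lact_incl {n : Fin k → ℕ} {s r : Λ} (f : s ⟶ r) (hf : D.degree f = n)
    (b : C0Sum S.A) (x : S.X f) :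
    (S.fibre n).lact b (S.incl f hf x) = S.incl f hf ((S.X f).lact (b.1 r) x) :=
  CStarCorr.lact_directSumIncl (fun p : D.Path n => (S.X p.hom).inflate) ⟨s, r, f, hf⟩ b x

theorem ract_incl {n : Fin k → ℕ} {s r : Λ} (f : s ⟶ r) (hf : D.degree f = n)
    (x : S.X f) (b : C0Sum S.A) :
    (S.fibre n).ract (S.incl f hf x) b = S.incl f hf ((S.X f).ract x (b.1 s)) :=
  CStarCorr.ract_directSumIncl (fun p : D.Path n => (S.X p.hom).inflate) ⟨s, r, f, hf⟩ x b

/-- The inclusion of `X f` in `Yₙ` as a linear isometry. -/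
noncomputable def inclL {n : Fin k → ℕ} {s r : Λ} (f : s ⟶ r) (hf : D.degree f = n) :
    (S.X f).carrier →ₗᵢ[ℂ] (S.fibre n).carrier :=
  CStarCorr.directSumInclL (fun p : D.Path n => (S.X p.hom).inflate) ⟨s, r, f, hf⟩

theorem incl_zero {n : Fin k → ℕ} {s r : Λ} (f : s ⟶ r) (hf : D.degree f = n) :
    S.incl f hf 0 = 0 := map_zero (S.inclL f hf)

theorem span_incl_dense (n : Fin k → ℕ) :
    (Submodule.span ℂ {z : S.fibre n | ∃ (s r : Λ) (f : s ⟶ r) (hf : D.degree f = n) (x : S.X f),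
      S.incl f hf x = z}).topologicalClosure = ⊤ := by
  refine Eq.trans ?_ (CStarCorr.span_directSumIncl_dense
    fun p : D.Path n => (S.X p.hom).inflate)
  change Submodule.topologicalClosure (M := (S.fibre n).carrier) _
    = Submodule.topologicalClosure (M := (S.fibre n).carrier) _
  congr 2
  ext z
  constructor
  · rintro ⟨s, r, f, hf, x, rfl⟩
    exact ⟨⟨s, r, f, hf⟩, x, rfl⟩
  · rintro ⟨⟨s, r, f, hf⟩, x, rfl⟩
    exact ⟨s, r, f, hf, x, rfl⟩

/-- The inclusions of the summands have dense span. Identities in the fibres are proved by freezing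
all variables but one, writing both sides as bounded maps of that variable, and applying this. -/
theorem fibre_ext {n : Fin k → ℕ} {F : Type*} [NormedAddCommGroup F] [NormedSpace ℂ F]
    {g h : (S.fibre n).carrier →L[ℂ] F}
    (H : ∀ {s r : Λ} (f : s ⟶ r) (hf : D.degree f = n) (x : S.X f),
      g (S.incl f hf x) = h (S.incl f hf x)) (y : S.fibre n) : g y = h y := by
  have : g = h := ContinuousLinearMap.ext_on
    (Submodule.dense_iff_topologicalClosure_eq_top.2 (S.span_incl_dense n)) (by
      rintro _ ⟨s, r, f, hf, x, rfl⟩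
      exact H f hf x)
  rw [this]

/-- The axioms for `chi` are equations in a disjoint union over morphisms; this moves them into a
single fibre. -/
theorem incl_congr {n : Fin k → ℕ} {s r : Λ} {f g : s ⟶ r} {x : S.X f} {y : S.X g}
    (h : (⟨f, x⟩ : Σ g : s ⟶ r, S.X g) = ⟨g, y⟩) (hf : D.degree f = n) (hg : D.degree g = n) :
    S.incl f hf x = S.incl g hg y := by
  cases h
  rfl

/-- The fibres over equal degrees are identified. -/
noncomputable def fibreCast {m n : Fin k → ℕ} (h : m = n) :
    (S.fibre m).carrier →L[ℂ] (S.fibre n).carrier :=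
  h ▸ ContinuousLinearMap.id ℂ (S.fibre m).carrier

/-- The axioms of a product system are equations in a disjoint union over degrees. After a cast they
become equations in one Banach space, where density arguments apply. -/
theorem sigma_eq_of_fibreCast {m n : Fin k → ℕ} (h : m = n) {x : S.fibre m} {y : S.fibre n}
    (e : S.fibreCast h x = y) : (⟨m, x⟩ : Σ p, S.fibre p) = ⟨n, y⟩ := by
  subst h
  subst e
  rfl

theorem fibreCast_incl {m n : Fin k → ℕ} (h : m = n) {s r : Λ} (f : s ⟶ r)
    (hf : D.degree f = m) (x : S.X f) :
    S.fibreCast h (S.incl f hf x) = S.incl f (hf.trans h) x := by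
  subst h
  rfl

/-- The bilinear map on fibres induced by bilinear maps on the summands. -/
theorem exists_fibreBilin {m n : Fin k → ℕ}
    (Z : CStarCorr.{max u a, max u a, w'} (C0Sum S.A) (C0Sum S.A))
    (b : ∀ (p : D.Path m) (q : D.Path n),
      (S.X p.hom).carrier →ₗ[ℂ] (S.X q.hom).carrier →ₗ[ℂ] Z.carrier)
    (hb : ∀ (p p' : D.Path m) (q q' : D.Path n)
      (x : S.X p.hom) (x' : S.X p'.hom) (y : S.X q.hom) (y' : S.X q'.hom),
      Z.inner (b p q x y) (b p' q' x' y')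
        = (S.fibre n).inner (S.incl q.hom q.degree_eq y) ((S.fibre n).lact
          ((S.fibre m).inner (S.incl p.hom p.degree_eq x) (S.incl p'.hom p'.degree_eq x'))
            (S.incl q'.hom q'.degree_eq y'))) :
    ∃ M : (S.fibre m).carrier →L[ℂ] (S.fibre n).carrier →L[ℂ] Z.carrier,
      (∀ (p : D.Path m) (q : D.Path n) (x : S.X p.hom) (y : S.X q.hom),
        M (S.incl p.hom p.degree_eq x) (S.incl q.hom q.degree_eq y) = b p q x y) ∧
      ∀ x x' y y', Z.inner (M x y) (M x' y')
        = (S.fibre n).inner y ((S.fibre n).lact ((S.fibre m).inner x x') y') :=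
  CStarCorr.exists_directSumBilin (fun p : D.Path m => (S.X p.hom).inflate)
    (fun p : D.Path n => (S.X p.hom).inflate) Z b
    (fun p p' q q' x x' y y' => hb p p' q q' x x' y y')

/-- The map of correspondences on a fibre induced by maps on the summands. -/
theorem exists_fibreLift {n : Fin k → ℕ}
    (Z : CStarCorr.{max u a, max u a, w'} (C0Sum S.A) (C0Sum S.A))
    (f : ∀ p : D.Path n, (S.X p.hom).carrier →ₗ[ℂ] Z.carrier)
    (hf : ∀ (p : D.Path n) (x y : S.X p.hom),
      Z.inner (f p x) (f p y) = C0Sum.single S.A p.src ((S.X p.hom).inner x y))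
    (hne : ∀ (p q : D.Path n) (x : S.X p.hom) (y : S.X q.hom), p ≠ q →
      Z.inner (f p x) (f q y) = 0)
    (hl : ∀ (p : D.Path n) (b : C0Sum S.A) (x : S.X p.hom),
      f p ((S.X p.hom).lact (b.1 p.rng) x) = Z.lact b (f p x)) :
    ∃ F : CStarCorr.Hom (S.fibre n) Z, ∀ (p : D.Path n) (x : S.X p.hom),
      F (S.incl p.hom p.degree_eq x) = f p x :=
  CStarCorr.exists_directSumLift (fun p : D.Path n => (S.X p.hom).inflate) Z f hf hne hl

/-! ### The multiplication -/

open scoped Classical in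
/-- The product `X α × X β → Y (m + n)` for paths `α`, `β` of degrees `m`, `n`. -/
noncomputable def mulComponent {m n : Fin k → ℕ} : ∀ (p : D.Path m) (q : D.Path n),
    (S.X p.hom).carrier →ₗ[ℂ] (S.X q.hom).carrier →ₗ[ℂ] (S.fibre (m + n)).carrier
  | ⟨v, r, α, hα⟩, ⟨t, v', β, hβ⟩ =>
    if h : v' = v then by
      subst h
      exact (CStarCorr.tmulL (S.X α) (S.X β)).toLinearMap₁₂.compr₂
        ((S.inclL (β ≫ α) (by rw [D.degree_comp, hα, hβ])).toLinearMap ∘ₗ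
          (S.chi α β).toLinearMap)
    else 0

theorem mulComponent_comp {m n : Fin k → ℕ} {t v r : Λ} (α : v ⟶ r) (β : t ⟶ v)
    (hα : D.degree α = m) (hβ : D.degree β = n) (x : S.X α) (y : S.X β) :
    S.mulComponent ⟨v, r, α, hα⟩ ⟨t, v, β, hβ⟩ x y
      = S.incl (β ≫ α) (by rw [D.degree_comp, hα, hβ])
          (S.chi α β ((S.X α).tmul (S.X β) x y)) := by
  rw [mulComponent, dif_pos rfl]
  rfl

theorem mulComponent_of_ne {m n : Fin k → ℕ} {t v v' r : Λ} (α : v ⟶ r) (β : t ⟶ v')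
    (hα : D.degree α = m) (hβ : D.degree β = n) (h : v ≠ v') (x : S.X α) (y : S.X β) :
    S.mulComponent ⟨v, r, α, hα⟩ ⟨t, v', β, hβ⟩ x y = 0 := by
  rw [mulComponent, dif_neg (Ne.symm h)]
  rfl

/-- The heart of the construction. For equal pairs of composable paths it holds because `χ`
preserves inner products; for different pairs both sides vanish, the right by orthogonality of
summands and the left by unique factorisation. -/
theorem inner_mulComponent {m n : Fin k → ℕ} : ∀ (p p' : D.Path m) (q q' : D.Path n)
    (x : S.X p.hom) (x' : S.X p'.hom) (y : S.X q.hom) (y' : S.X q'.hom),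
    (S.fibre (m + n)).inner (S.mulComponent p q x y) (S.mulComponent p' q' x' y')
      = (S.fibre n).inner (S.incl q.hom q.degree_eq y) ((S.fibre n).lact
        ((S.fibre m).inner (S.incl p.hom p.degree_eq x) (S.incl p'.hom p'.degree_eq x'))
          (S.incl q'.hom q'.degree_eq y')) := by
  rintro ⟨v, r, α, hα⟩ ⟨v', r', α', hα'⟩ ⟨t, c, β, hβ⟩ ⟨t', c', β', hβ'⟩ x x' y y'
  dsimp only at x x' y y' ⊢
  by_cases hp : (⟨v, r, α, hα⟩ : D.Path m) = ⟨v', r', α', hα'⟩ ∧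
      (⟨t, c, β, hβ⟩ : D.Path n) = ⟨t', c', β', hβ'⟩
  · obtain ⟨hp, hq⟩ := hp
    cases hp
    cases hq
    simp only [S.lact_incl, S.inner_incl_self]
    by_cases hc : v = c
    · subst hc
      simp only [S.mulComponent_comp, S.inner_incl_self, C0Sum.single_apply_self]
      exact congrArg _ (((S.chi α β).map_inner _ _).trans (CStarCorr.inner_tmul _ _ _ _ _ _))
    -- `⟨x, x'⟩` is supported at the vertex `v`, while `X β` is acted on through the coordinate `c ≠
    -- v`, so the right side is zero too.
    · simp only [S.mulComponent_of_ne _ _ _ _ hc, C0Sum.single_apply_of_ne (Ne.symm hc)]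
      simp
  · have h1 : (S.fibre n).inner (S.incl β hβ y) ((S.fibre n).lact
        ((S.fibre m).inner (S.incl α hα x) (S.incl α' hα' x')) (S.incl β' hβ' y')) = 0 := by
      rw [not_and_or] at hp
      rcases hp with hp | hp
      · simp only [S.inner_incl_of_ne _ _ _ _ hp]
        simp
      · simp only [S.lact_incl, S.inner_incl_of_ne _ _ _ _ hp]
    rw [h1]
    by_cases hc : v = c
    · subst hc
      by_cases hc' : v' = c'
      · subst hc'
        simp only [S.mulComponent_comp]
        -- If the two composites were the same path, their factors of degrees `m` and `n` would
        -- agree, contrary to `hp`.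
        exact S.inner_incl_of_ne _ _ _ _ (fun e => hp (D.path_comp_injective hα hβ hα' hβ' e)) _ _
      · simp only [S.mulComponent_of_ne α' _ _ _ hc', map_zero]
    · simp only [S.mulComponent_of_ne α _ _ _ hc, map_zero, LinearMap.zero_apply]

theorem exists_mul (m n : Fin k → ℕ) :
    ∃ M : (S.fibre m).carrier →L[ℂ] (S.fibre n).carrier →L[ℂ] (S.fibre (m + n)).carrier,
      (∀ (p : D.Path m) (q : D.Path n) (x : S.X p.hom) (y : S.X q.hom),
        M (S.incl p.hom p.degree_eq x) (S.incl q.hom q.degree_eq y) = S.mulComponent p q x y) ∧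
      ∀ x x' y y', (S.fibre (m + n)).inner (M x y) (M x' y')
        = (S.fibre n).inner y ((S.fibre n).lact ((S.fibre m).inner x x') y') :=
  S.exists_fibreBilin _ S.mulComponent S.inner_mulComponent

/-- The multiplication `Y m × Y n → Y (m + n)`. -/
noncomputable def fibreMul (m n : Fin k → ℕ) :
    (S.fibre m).carrier →L[ℂ] (S.fibre n).carrier →L[ℂ] (S.fibre (m + n)).carrier :=
  (S.exists_mul m n).choose

theorem inner_fibreMul {m n : Fin k → ℕ} (x x' : S.fibre m) (y y' : S.fibre n) :
    (S.fibre (m + n)).inner (S.fibreMul m n x y) (S.fibreMul m n x' y')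
      = (S.fibre n).inner y ((S.fibre n).lact ((S.fibre m).inner x x') y') :=
  (S.exists_mul m n).choose_spec.2 x x' y y'

theorem fibreMul_incl {m n : Fin k → ℕ} {t v r : Λ} (α : v ⟶ r) (β : t ⟶ v)
    (hα : D.degree α = m) (hβ : D.degree β = n) (x : S.X α) (y : S.X β) :
    S.fibreMul m n (S.incl α hα x) (S.incl β hβ y)
      = S.incl (β ≫ α) (by rw [D.degree_comp, hα, hβ])
          (S.chi α β ((S.X α).tmul (S.X β) x y)) :=
  ((S.exists_mul m n).choose_spec.1 ⟨v, r, α, hα⟩ ⟨t, v, β, hβ⟩ x y).trans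
    (S.mulComponent_comp α β hα hβ x y)

theorem fibreMul_incl_of_ne {m n : Fin k → ℕ} {t v v' r : Λ} (α : v ⟶ r) (β : t ⟶ v')
    (hα : D.degree α = m) (hβ : D.degree β = n) (h : v ≠ v') (x : S.X α) (y : S.X β) :
    S.fibreMul m n (S.incl α hα x) (S.incl β hβ y) = 0 :=
  ((S.exists_mul m n).choose_spec.1 ⟨v, r, α, hα⟩ ⟨t, v', β, hβ⟩ x y).trans
    (S.mulComponent_of_ne α β hα hβ h x y)

theorem fibreMul_lact {m n : Fin k → ℕ} (b : C0Sum S.A) (x : S.fibre m) (y : S.fibre n) :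
    S.fibreMul m n ((S.fibre m).lact b x) y = (S.fibre (m + n)).lact b (S.fibreMul m n x y) := by
  refine S.fibre_ext (g := ((S.fibreMul m n).flip y).comp ((S.fibre m).lact b))
    (h := ((S.fibre (m + n)).lact b).comp ((S.fibreMul m n).flip y)) (fun {v r} α hα x => ?_) x
  refine S.fibre_ext (g := S.fibreMul m n ((S.fibre m).lact b (S.incl α hα x)))
    (h := ((S.fibre (m + n)).lact b).comp (S.fibreMul m n (S.incl α hα x)))
    (fun {t v'} β hβ y => ?_) y
  simp only [ContinuousLinearMap.comp_apply, S.lact_incl]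
  by_cases hv : v = v'
  · subst hv
    simp only [S.fibreMul_incl, S.lact_incl, ← CStarCorr.lact_tmul]
    exact congrArg _ ((S.chi α β).map_lact _ _)
  · simp only [S.fibreMul_incl_of_ne _ _ _ _ hv, map_zero]

/-- Density in each of the three variables reduces this to summands. There it is `chi_assoc` when
all three paths compose, and otherwise both sides are zero. -/
theorem fibreMul_assoc {l m n : Fin k → ℕ} (x : S.fibre l) (y : S.fibre m) (z : S.fibre n) :
    S.fibreCast (add_assoc l m n) (S.fibreMul (l + m) n (S.fibreMul l m x y) z)
      = S.fibreMul l (m + n) x (S.fibreMul m n y z) := by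
  refine S.fibre_ext
    (g := (S.fibreCast (add_assoc l m n)).comp
      (((S.fibreMul (l + m) n).flip z).comp ((S.fibreMul l m).flip y)))
    (h := (S.fibreMul l (m + n)).flip (S.fibreMul m n y z)) (fun {v r} α hα x => ?_) x
  refine S.fibre_ext
    (g := (S.fibreCast (add_assoc l m n)).comp
      (((S.fibreMul (l + m) n).flip z).comp (S.fibreMul l m (S.incl α hα x))))
    (h := (S.fibreMul l (m + n) (S.incl α hα x)).comp ((S.fibreMul m n).flip z))
    (fun {t v'} β hβ y => ?_) y
  refine S.fibre_ext
    (g := (S.fibreCast (add_assoc l m n)).comp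
      (S.fibreMul (l + m) n (S.fibreMul l m (S.incl α hα x) (S.incl β hβ y))))
    (h := (S.fibreMul l (m + n) (S.incl α hα x)).comp (S.fibreMul m n (S.incl β hβ y)))
    (fun {s t'} γ hγ z => ?_) z
  simp only [ContinuousLinearMap.comp_apply, ContinuousLinearMap.comp_apply]
  by_cases hv : v = v'
  · subst hv
    simp only [S.fibreMul_incl α β]
    by_cases ht : t = t'
    · subst ht
      simp only [S.fibreMul_incl _ γ, S.fibreMul_incl α, S.fibreCast_incl]
      exact S.incl_congr (S.chi_assoc α β γ x y z) _ _
    · simp only [S.fibreMul_incl_of_ne _ γ _ _ ht, map_zero]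
  · simp only [S.fibreMul_incl_of_ne α β _ _ hv, map_zero, zero_apply, map_zero]
    -- The product of `y` and `z` need not vanish, but it lies in a summand whose path has the range
    -- of `β`, so multiplying by `x` still gives zero.
    by_cases ht : t = t'
    · subst ht
      simp only [S.fibreMul_incl β γ, S.fibreMul_incl_of_ne α _ _ _ hv]
    · simp only [S.fibreMul_incl_of_ne β γ _ _ ht, map_zero]

/-! ### The identification of `Y 0` with the `c₀`-sum -/

/-- A path of degree zero equals some `idPath b` only propositionally, whereas `S.unit` lives over
`𝟙 b`. The components are therefore chosen, with a specification that transports along this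
equality. -/
theorem exists_unitComponent : ∃ F : ∀ p : D.Path 0, (S.X p.hom).carrier →ₗ[ℂ] C0Sum S.A,
    ∀ (b : Λ) (e : S.X (𝟙 b)), F (D.idPath b) e = C0Sum.single S.A b (S.unit b e) := by
  have h : ∀ p : D.Path 0, ∃ F : (S.X p.hom).carrier →ₗ[ℂ] C0Sum S.A,
      ∀ (b : Λ) (hb : p = D.idPath b) (e : S.X p.hom),
        F e = C0Sum.single S.A b (S.unit b (hb ▸ e : S.X (D.idPath b).hom)) := by
    intro p
    obtain ⟨b, rfl⟩ := D.exists_eq_idPath p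
    refine ⟨C0Sum.single S.A b ∘ₗ (S.unit b).toLinearMap, fun b' hb e => ?_⟩
    obtain rfl : b = b' := congrArg KGraph.Path.src hb
    rfl
  choose F hF using h
  exact ⟨F, fun b e => hF _ b rfl e⟩

set_option maxHeartbeats 400000 in
-- Both in `Y 0` and in `A` the summands at different vertices are orthogonal for `⟨x, y⟩ = x⋆y`,
-- and on each summand `S.unit` respects inner products and left actions.
theorem exists_unitHom : ∃ U : CStarCorr.Hom (S.fibre 0) (CStarCorr.ident (C0Sum S.A)),
    ∀ (b : Λ) (e : S.X (𝟙 b)),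
      U (S.incl (𝟙 b) (D.degree_id b) e) = C0Sum.single S.A b (S.unit b e) := by
  obtain ⟨F, hF⟩ := S.exists_unitComponent
  have h1 : ∀ (b : Λ) (x y : S.X (𝟙 b)), star (F (D.idPath b) x) * F (D.idPath b) y
      = C0Sum.single S.A b ((S.X (𝟙 b)).inner x y) := fun b x y =>
    (congrArg₂ (fun s t => star s * t) (hF b x) (hF b y)).trans <|
      (C0Sum.star_single_mul_single b (S.unit b x) (S.unit b y)).trans
        (congrArg (C0Sum.single S.A b) ((S.unit b).map_inner x y))
  have h2 : ∀ (b c : Λ) (x : S.X (𝟙 b)) (y : S.X (𝟙 c)), b ≠ c →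
      star (F (D.idPath b) x) * F (D.idPath c) y = 0 := fun b c x y h =>
    (congrArg₂ (fun s t => star s * t) (hF b x) (hF c y)).trans <|
      C0Sum.star_single_mul_single_of_ne h.symm _ _
  have h3 : ∀ (b : Λ) (c : C0Sum S.A) (x : S.X (𝟙 b)),
      F (D.idPath b) ((S.X (𝟙 b)).lact (c.1 b) x) = c * F (D.idPath b) x := fun b c x =>
    (hF b _).trans <| (congrArg (C0Sum.single S.A b) ((S.unit b).map_lact (c.1 b) x)).trans <|
      (C0Sum.mul_single b (S.unit b x) c).symm.trans (congrArg (c * ·) (hF b x)).symm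
  obtain ⟨U, hU⟩ := S.exists_fibreLift (CStarCorr.ident (C0Sum S.A)) F (by
      intro p x y
      obtain ⟨b, rfl⟩ := D.exists_eq_idPath p
      exact (CStarCorr.ident_inner (F (D.idPath b) x) (F (D.idPath b) y)).trans (h1 b x y)) (by
      intro p q x y hpq
      obtain ⟨b, rfl⟩ := D.exists_eq_idPath p
      obtain ⟨c, rfl⟩ := D.exists_eq_idPath q
      exact (CStarCorr.ident_inner (F (D.idPath b) x) (F (D.idPath c) y)).trans <|
        h2 b c x y (fun h => hpq (h ▸ rfl))) (by
      intro p c x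
      obtain ⟨b, rfl⟩ := D.exists_eq_idPath p
      exact (h3 b c x).trans (CStarCorr.ident_lact c (F (D.idPath b) x)).symm)
  exact ⟨U, fun b e => (hU (D.idPath b) e).trans (hF b e)⟩

/-- The map of correspondences `Y 0 → A`. -/
noncomputable def fibreUnit : CStarCorr.Hom (S.fibre 0) (CStarCorr.ident (C0Sum S.A)) :=
  S.exists_unitHom.choose

theorem fibreUnit_incl (b : Λ) (e : S.X (𝟙 b)) :
    S.fibreUnit (S.incl (𝟙 b) (D.degree_id b) e) = C0Sum.single S.A b (S.unit b e) :=
  S.exists_unitHom.choose_spec b e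

theorem fibreUnit_isIso : S.fibreUnit.IsIso := by
  refine S.fibreUnit.isIso_ident_of_dense _ C0Sum.span_single_dense ?_
  rintro _ ⟨b, c, rfl⟩
  obtain ⟨e, he⟩ := (S.unit_isIso b).2 c
  exact ⟨_, (S.fibreUnit_incl b e).trans (congrArg (C0Sum.single S.A b) he)⟩

end LambdaSystem

/-! ### Closed spans -/

/-- A continuous linear map sends the closed span of `s` into a closed subspace which contains the
image of `s`. -/
theorem ContinuousLinearMap.mem_of_mem_closure_span {E F : Type*} [NormedAddCommGroup E]
    [NormedSpace ℂ E] [NormedAddCommGroup F] [NormedSpace ℂ F] (T : E →L[ℂ] F) {s : Set E}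
    {P : Submodule ℂ F} (hP : IsClosed (P : Set F)) (h : ∀ x ∈ s, T x ∈ P) {z : E}
    (hz : z ∈ (Submodule.span ℂ s).topologicalClosure) : T z ∈ P :=
  Submodule.topologicalClosure_minimal (t := P.comap T.toLinearMap) _ (Submodule.span_le.2 h)
    (hP.preimage T.continuous) hz

theorem Submodule.eq_top_of_subset_of_dense {E : Type*} [NormedAddCommGroup E] [NormedSpace ℂ E]
    {s : Set E} (hs : (Submodule.span ℂ s).topologicalClosure = ⊤) {P : Submodule ℂ E}
    (hP : IsClosed (P : Set E)) (h : ∀ x ∈ s, x ∈ P) : P = ⊤ :=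
  top_unique (hs.ge.trans
    (Submodule.topologicalClosure_minimal _ (Submodule.span_le.2 h) hP))

theorem Submodule.mem_of_eq_top {E : Type*} [NormedAddCommGroup E] [NormedSpace ℂ E]
    {P : Submodule ℂ E} (hP : P = ⊤) (x : E) : x ∈ P := hP ▸ Submodule.mem_top

/-! ### What determines a product system structure -/

namespace ProductSystem

variable {P : Type v} [AddMonoid P] {A : Type u} [NonUnitalCStarAlgebra A]
  {Y : P → CStarCorr.{u, u, w} A A}

/-- Continuity is not among the axioms. It follows from factoring the product as the bounded
bilinear map `(x, y) ↦ x ⊗ y` followed by the isometry `Θ`. -/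
theorem exists_mulL (Z : ProductSystem Y) {p q : P} (hp : p ≠ 0) (hq : q ≠ 0) :
    ∃ M : (Y p).carrier →L[ℂ] (Y q).carrier →L[ℂ] (Y (p + q)).carrier,
      ∀ x y, M x y = Z.mul x y := by
  obtain ⟨Θ, -, hΘ⟩ := Z.exists_iso p q hp hq
  exact ⟨(ContinuousLinearMap.compL ℂ _ _ _ Θ.toIsometry.toContinuousLinearMap).comp
    ((Y p).tmulL (Y q)), hΘ⟩

/-- A product system structure is determined by its unit and by the products of degrees
`p, q ≠ 0`. -/
theorem ext_of_unit {Z Z' : ProductSystem Y} (hU : Z.unit = Z'.unit)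
    (hM : ∀ {p q : P}, p ≠ 0 → q ≠ 0 → ∀ (x : Y p) (y : Y q), Z.mul x y = Z'.mul x y) :
    Z = Z' := by
  have h : ∀ {p q : P} (x : Y p) (y : Y q), Z.mul x y = Z'.mul x y := by
    intro p q x y
    -- In degree zero the axioms offer no `Θ`, but the product is the action of `A` through the
    -- unit, so equality of the units settles it.
    by_cases hp : p = 0
    · subst hp
      have h := Z.unit_mul x y
      rw [hU, ← Z'.unit_mul x y] at h
      exact eq_of_heq (Sigma.mk.inj h).2
    by_cases hq : q = 0
    · subst hq
      have h := Z.mul_unit x y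
      rw [hU, ← Z'.mul_unit x y] at h
      exact eq_of_heq (Sigma.mk.inj h).2
    exact hM hp hq x y
  obtain ⟨mul, _, unit, _, _, _, _⟩ := Z
  obtain ⟨mul', _, unit', _, _, _, _⟩ := Z'
  obtain rfl : unit = unit' := hU
  obtain rfl : @mul = @mul' := by
    funext p q x y
    exact h x y
  rfl

end ProductSystem

/-! ### Existence and uniqueness of the product system -/

namespace LambdaSystem

variable {k : ℕ} {Λ : Type u} [CategoryTheory.Category.{v} Λ] {D : KGraph k Λ}
  (S : LambdaSystem.{u, v, w, a} D)

/-- The map of correspondences `Y m ⊗ Y n → Y (m + n)` induced by the multiplication. -/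
noncomputable def fibreTensorMul (m n : Fin k → ℕ) :
    CStarCorr.Hom ((S.fibre m).tensor (S.fibre n)) (S.fibre (m + n)) :=
  CStarCorr.tensorLift (S.fibre (m + n)) (S.fibreMul m n).toLinearMap₁₂
    (fun x y x' y' => S.inner_fibreMul x x' y y') (fun b x y => S.fibreMul_lact b x y)

theorem fibreTensorMul_tmul {m n : Fin k → ℕ} (x : S.fibre m) (y : S.fibre n) :
    S.fibreTensorMul m n ((S.fibre m).tmul (S.fibre n) x y) = S.fibreMul m n x y :=
  CStarCorr.tensorLift_tmul (S.fibre (m + n)) _ _ _ x y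

/-- This is where existence of factorisations is used: a generator over `f` lies in the summand of a
composite `αβ` with degrees `m` and `n`, and there it is a limit of sums of products `χ(x ⊗ y)`. -/
theorem span_incl_chi_dense {m n : Fin k → ℕ} (hm : m ≠ 0) :
    (Submodule.span ℂ {z : S.fibre (m + n) | ∃ (t v r : Λ) (α : v ⟶ r) (β : t ⟶ v)
      (hα : D.degree α = m) (hβ : D.degree β = n) (x : S.X α) (y : S.X β),
      S.fibreMul m n (S.incl α hα x) (S.incl β hβ y) = z}).topologicalClosure = ⊤ := by
  refine Submodule.eq_top_of_subset_of_dense (S.span_incl_dense (m + n))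
    (Submodule.isClosed_topologicalClosure _) ?_
  rintro _ ⟨t, r, f, hf, z, rfl⟩
  obtain ⟨⟨v, α, β⟩, ⟨hα, hβ, h⟩, -⟩ := D.factorisation f m n hf
  dsimp only at hα hβ h
  subst h
  -- Surjectivity of `χ` is available because `α` has degree `m ≠ 0`.
  obtain ⟨z, rfl⟩ := (S.chi_isIso α β (hα ▸ hm)).2 z
  let T : ((S.X α).tensor (S.X β)).carrier →L[ℂ] (S.fibre (m + n)).carrier :=
    (S.inclL (β ≫ α) hf).toContinuousLinearMap.comp (S.chi α β).toIsometry.toContinuousLinearMap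
  refine T.mem_of_mem_closure_span (Submodule.isClosed_topologicalClosure _) ?_
    (Submodule.mem_of_eq_top (CStarCorr.span_tmul_dense (S.X α) (S.X β)) z)
  rintro _ ⟨x, y, rfl⟩
  exact Submodule.le_topologicalClosure _ (Submodule.subset_span
    ⟨t, v, r, α, β, hα, hβ, x, y, S.fibreMul_incl α β hα hβ x y⟩)

theorem fibreTensorMul_isIso {m n : Fin k → ℕ} (hm : m ≠ 0) : (S.fibreTensorMul m n).IsIso := by
  refine (S.fibreTensorMul m n).isIso_of_dense _ (S.span_incl_chi_dense hm) ?_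
  rintro _ ⟨t, v, r, α, β, hα, hβ, x, y, rfl⟩
  exact ⟨_, S.fibreTensorMul_tmul _ _⟩

/-- Continuous linear maps on `Y 0` which agree on the summands `X (𝟙 b)` are equal. -/
theorem fibre_zero_ext {F : Type*} [NormedAddCommGroup F] [NormedSpace ℂ F]
    {g h : (S.fibre 0).carrier →L[ℂ] F}
    (H : ∀ (b : Λ) (e : S.X (𝟙 b)),
      g (S.incl (𝟙 b) (D.degree_id b) e) = h (S.incl (𝟙 b) (D.degree_id b) e))
    (y : S.fibre 0) : g y = h y := by
  refine S.fibre_ext (fun {s r} f hf x => ?_) y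
  obtain ⟨b, hb⟩ := D.exists_eq_idPath ⟨s, r, f, hf⟩
  cases hb
  exact H _ x

/-- The identification of `Y 0` with `A` as a continuous linear map. -/
noncomputable def fibreUnitL (U : CStarCorr.Hom (S.fibre 0) (CStarCorr.ident (C0Sum S.A))) :
    (S.fibre 0).carrier →L[ℂ] C0Sum S.A :=
  U.toIsometry.toContinuousLinearMap

theorem fibreUnitL_incl (b : Λ) (e : S.X (𝟙 b)) :
    S.fibreUnitL S.fibreUnit (S.incl (𝟙 b) (D.degree_id b) e)
      = C0Sum.single S.A b (S.unit b e) :=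
  S.fibreUnit_incl b e

/-- On summands this is `chi_range` when the vertex of `e` is the range of `f`. Otherwise both sides
vanish: the paths do not compose, and the element of `A` given by `e` has zero coordinate at that
range. -/
theorem fibreUnit_mul {n : Fin k → ℕ} (e : S.fibre 0) (y : S.fibre n) :
    S.fibreCast (zero_add n) (S.fibreMul 0 n e y)
      = (S.fibre n).lact (S.fibreUnitL S.fibreUnit e) y := by
  refine S.fibre_zero_ext
    (g := (S.fibreCast (zero_add n)).comp ((S.fibreMul 0 n).flip y))
    (h := ((S.fibre n).lactL.flip y).comp (S.fibreUnitL S.fibreUnit)) (fun b e => ?_) e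
  refine S.fibre_ext
    (g := (S.fibreCast (zero_add n)).comp (S.fibreMul 0 n (S.incl (𝟙 b) (D.degree_id b) e)))
    (h := (S.fibre n).lact (S.fibreUnitL S.fibreUnit (S.incl (𝟙 b) (D.degree_id b) e)))
    (fun {s r} f hf y => ?_) y
  simp only [ContinuousLinearMap.comp_apply, S.fibreUnitL_incl, S.lact_incl]
  by_cases hb : b = r
  · subst hb
    simp only [S.fibreMul_incl, S.fibreCast_incl]
    refine S.incl_congr ((S.chi_range f e y).trans ?_) _ _
    exact congrArg (fun c => (⟨f, (S.X f).lact c y⟩ : Σ g : s ⟶ b, S.X g))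
      (C0Sum.single_apply_self b (S.unit b e)).symm
  · simp only [S.fibreMul_incl_of_ne _ _ _ _ hb, map_zero]
    refine Eq.symm (Eq.trans (congrArg (fun c => S.incl f hf ((S.X f).lact c y))
      (C0Sum.single_apply_of_ne (Ne.symm hb) (S.unit b e))) ?_)
    simp only [map_zero, zero_apply, S.incl_zero]

/-- As for the left action, with `chi_source` and the coordinate at the source of `f`. -/
theorem fibreMul_unit {n : Fin k → ℕ} (y : S.fibre n) (e : S.fibre 0) :
    S.fibreCast (add_zero n) (S.fibreMul n 0 y e)
      = (S.fibre n).ract y (S.fibreUnitL S.fibreUnit e) := by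
  refine S.fibre_zero_ext
    (g := (S.fibreCast (add_zero n)).comp (S.fibreMul n 0 y))
    (h := ((S.fibre n).ractL y).comp (S.fibreUnitL S.fibreUnit)) (fun b e => ?_) e
  refine S.fibre_ext
    (g := (S.fibreCast (add_zero n)).comp
      ((S.fibreMul n 0).flip (S.incl (𝟙 b) (D.degree_id b) e)))
    (h := (S.fibre n).ractL.flip (S.fibreUnitL S.fibreUnit (S.incl (𝟙 b) (D.degree_id b) e)))
    (fun {s r} f hf y => ?_) y
  simp only [ContinuousLinearMap.comp_apply, ContinuousLinearMap.flip_apply, S.fibreUnitL_incl,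
    CStarCorr.ractL_apply, S.ract_incl]
  by_cases hb : s = b
  · subst hb
    simp only [S.fibreMul_incl, S.fibreCast_incl]
    refine S.incl_congr ((S.chi_source f y e).trans ?_) _ _
    exact congrArg (fun c => (⟨f, (S.X f).ract y c⟩ : Σ g : s ⟶ r, S.X g))
      (C0Sum.single_apply_self s (S.unit s e)).symm
  · simp only [S.fibreMul_incl_of_ne _ _ _ _ hb, map_zero]
    refine Eq.symm (Eq.trans (congrArg (fun c => S.incl f hf ((S.X f).ract y c))
      (C0Sum.single_apply_of_ne hb (S.unit b e))) ?_)
    simp only [map_zero, S.incl_zero]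

/-- The product system of a `Λ`-system. -/
noncomputable def productSystem : ProductSystem S.fibre where
  mul x y := S.fibreMul _ _ x y
  mul_assoc x y z := S.sigma_eq_of_fibreCast (add_assoc _ _ _) (S.fibreMul_assoc x y z)
  unit := S.fibreUnit
  unit_isIso := S.fibreUnit_isIso
  exists_iso p q hp _ :=
    ⟨S.fibreTensorMul p q, S.fibreTensorMul_isIso hp, fun x y => S.fibreTensorMul_tmul x y⟩
  unit_mul e y := S.sigma_eq_of_fibreCast (zero_add _) (S.fibreUnit_mul e y)
  mul_unit y e := S.sigma_eq_of_fibreCast (add_zero _) (S.fibreMul_unit y e)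

/-- A product system structure is determined by its unit and its products of elements of the
summands. -/
theorem productSystem_eq (Y Y' : ProductSystem S.fibre)
    (hu : ∀ (b : Λ) (e : S.X (𝟙 b)), Y.unit (S.incl (𝟙 b) (D.degree_id b) e)
      = Y'.unit (S.incl (𝟙 b) (D.degree_id b) e))
    (hm : ∀ {m n : Fin k → ℕ} {s r s' r' : Λ} (α : s ⟶ r) (β : s' ⟶ r') (hα : D.degree α = m)
      (hβ : D.degree β = n) (x : S.X α) (y : S.X β),
      Y.mul (S.incl α hα x) (S.incl β hβ y) = Y'.mul (S.incl α hα x) (S.incl β hβ y)) :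
    Y = Y' := by
  refine ProductSystem.ext_of_unit (CStarCorr.Hom.ext' fun e =>
    S.fibre_zero_ext (g := S.fibreUnitL Y.unit) (h := S.fibreUnitL Y'.unit) hu e) ?_
  intro p q hp hq x y
  obtain ⟨M, hM⟩ := Y.exists_mulL hp hq
  obtain ⟨M', hM'⟩ := Y'.exists_mulL hp hq
  refine (hM x y).symm.trans (Eq.trans ?_ (hM' x y))
  refine S.fibre_ext (g := M.flip y) (h := M'.flip y) (fun α hα x => ?_) x
  exact S.fibre_ext (g := M (S.incl α hα x)) (h := M' (S.incl α hα x)) (fun β hβ y =>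
    (hM _ _).trans ((hm α β hα hβ x y).trans (hM' _ _).symm)) y

end LambdaSystem

/-! ### The left action in the regular case -/

namespace CStarCorr

variable {A : Type u} {B : Type v} [NonUnitalCStarAlgebra A] [NonUnitalCStarAlgebra B]

theorem rankOne_apply (X : CStarCorr.{u, v, w} A B) (x y z : X) :
    X.rankOne x y z = X.ract x (X.inner y z) := rfl

end CStarCorr

namespace LambdaSystem

variable {k : ℕ} {Λ : Type u} [CategoryTheory.Category.{v} Λ] {D : KGraph k Λ}
  (S : LambdaSystem.{u, v, w, a} D)

/-- The projection of `Yₙ` onto `X f`. -/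
noncomputable def proj {n : Fin k → ℕ} {s r : Λ} (f : s ⟶ r) (hf : D.degree f = n) :
    (S.fibre n).carrier →L[ℂ] (S.X f).carrier :=
  CStarCorr.directSumProj (fun p : D.Path n => (S.X p.hom).inflate) ⟨s, r, f, hf⟩

theorem proj_incl_self {n : Fin k → ℕ} {s r : Λ} (f : s ⟶ r) (hf : D.degree f = n)
    (x : S.X f) : S.proj f hf (S.incl f hf x) = x :=
  CStarCorr.directSumProj_incl_self (fun p : D.Path n => (S.X p.hom).inflate) ⟨s, r, f, hf⟩ x

theorem proj_incl_of_ne {n : Fin k → ℕ} {s r s' r' : Λ} (f : s ⟶ r) (hf : D.degree f = n)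
    (g : s' ⟶ r') (hg : D.degree g = n)
    (h : (⟨s, r, f, hf⟩ : D.Path n) ≠ ⟨s', r', g, hg⟩) (x : S.X g) :
    S.proj f hf (S.incl g hg x) = 0 :=
  CStarCorr.directSumProj_incl_of_ne (fun p : D.Path n => (S.X p.hom).inflate) h x

/-- Within a summand, `ι_f(b · x)` is the action on `ι_f(x)` of the copy of `b` in `A`, so vectors
approximated in `X f` are approximated in the fibre. -/
theorem fibre_isNondegenerate (h : ∀ {s r : Λ} (f : s ⟶ r), (S.X f).IsNondegenerate)
    (n : Fin k → ℕ) : (S.fibre n).IsNondegenerate := by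
  refine Submodule.eq_top_of_subset_of_dense (S.span_incl_dense n)
    (Submodule.isClosed_topologicalClosure _) ?_
  rintro _ ⟨s, r, f, hf, z, rfl⟩
  let T : (S.X f).carrier →L[ℂ] (S.fibre n).carrier := (S.inclL f hf).toContinuousLinearMap
  refine T.mem_of_mem_closure_span (Submodule.isClosed_topologicalClosure _) ?_
    (Submodule.mem_of_eq_top (h f) z)
  rintro _ ⟨b, x, rfl⟩
  refine Submodule.le_topologicalClosure _ (Submodule.subset_span
    ⟨C0Sum.single S.A r b, S.incl f hf x, ?_⟩)
  simp only [S.lact_incl f hf, C0Sum.single_apply_self]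
  rfl

theorem fibre_lact_injective (hD : D.IsRowFiniteNoSources)
    (h : ∀ {s r : Λ} (f : s ⟶ r), Function.Injective (S.X f).lact) (n : Fin k → ℕ) :
    Function.Injective (S.fibre n).lact := by
  rw [injective_iff_map_eq_zero]
  intro b hb
  refine Subtype.ext (lp.ext (funext fun r => ?_))
  -- A path of degree `n` ending at `r` exists, and on its summand `b` acts faithfully through the
  -- coordinate `b r`.
  obtain ⟨⟨s, _, f, hf⟩, rfl⟩ := (hD r n).2
  refine (injective_iff_map_eq_zero (S.X f).lact).1 (h f) _ ?_
  ext x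
  refine (S.inclL f hf).injective ((S.lact_incl f hf b x).symm.trans ?_)
  exact (congrArg (fun T => T (S.incl f hf x)) hb).trans (S.incl_zero f hf).symm

/-- The extension by zero of an operator on `X f` to `Yₙ`. -/
noncomputable def extendOp {n : Fin k → ℕ} {s r : Λ} (f : s ⟶ r) (hf : D.degree f = n) :
    ((S.X f).carrier →L[ℂ] (S.X f).carrier) →L[ℂ]
      ((S.fibre n).carrier →L[ℂ] (S.fibre n).carrier) :=
  (ContinuousLinearMap.compL ℂ (S.fibre n).carrier (S.X f).carrier (S.fibre n).carrier
    (S.inclL f hf).toContinuousLinearMap).comp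
      ((ContinuousLinearMap.compL ℂ (S.fibre n).carrier (S.X f).carrier (S.X f).carrier).flip
        (S.proj f hf))

theorem extendOp_apply {n : Fin k → ℕ} {s r : Λ} (f : s ⟶ r) (hf : D.degree f = n)
    (T : (S.X f).carrier →L[ℂ] (S.X f).carrier) (z : S.fibre n) :
    S.extendOp f hf T z = S.incl f hf (T (S.proj f hf z)) := rfl

/-- Off the summand of `f`, the left operator dies by the projection and the right one by
orthogonality. -/
theorem extendOp_rankOne {n : Fin k → ℕ} {s r : Λ} (f : s ⟶ r) (hf : D.degree f = n)
    (x y : S.X f) :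
    S.extendOp f hf ((S.X f).rankOne x y)
      = (S.fibre n).rankOne (S.incl f hf x) (S.incl f hf y) := by
  refine ContinuousLinearMap.ext fun z => S.fibre_ext (fun {s' r'} g hg z => ?_) z
  simp only [extendOp_apply, CStarCorr.rankOne_apply, S.ract_incl]
  by_cases h : (⟨s, r, f, hf⟩ : D.Path n) = ⟨s', r', g, hg⟩
  · cases h
    simp only [S.proj_incl_self, S.inner_incl_self, C0Sum.single_apply_self]
  · rw [S.proj_incl_of_ne f hf g hg h, S.inner_incl_of_ne f hf g hg h]
    simp only [map_zero]
    exact congrArg (S.incl f hf) (map_zero ((S.X f).ract x)).symm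

/-- Extension by zero is bounded and linear in the operator and takes rank-one operators to rank-one
operators, so it respects their closed spans. -/
theorem extendOp_mem_compactOperators {n : Fin k → ℕ} {s r : Λ} (f : s ⟶ r)
    (hf : D.degree f = n) {T : (S.X f).carrier →L[ℂ] (S.X f).carrier}
    (hT : T ∈ (S.X f).compactOperators) :
    S.extendOp f hf T ∈ (S.fibre n).compactOperators := by
  refine (S.extendOp f hf).mem_of_mem_closure_span (Submodule.isClosed_topologicalClosure _) ?_ hT
  rintro _ ⟨x, y, rfl⟩
  exact Submodule.le_topologicalClosure _ (Submodule.subset_span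
    ⟨_, _, S.extendOp_rankOne f hf x y⟩)

/-- An element supported at `r` kills every summand whose path does not end at `r`. In the sum, `b`
appears as the coordinate at `p.rng`, which avoids transporting it along `p.rng = r`. -/
theorem lact_single_eq_sum {n : Fin k → ℕ} (r : Λ) (hfin : {p : D.Path n | p.rng = r}.Finite)
    (b : S.A r) :
    (S.fibre n).lact (C0Sum.single S.A r b) = ∑ p ∈ hfin.toFinset,
      S.extendOp p.hom p.degree_eq ((S.X p.hom).lact ((C0Sum.single S.A r b).1 p.rng)) := by
  classical
  refine ContinuousLinearMap.ext fun z => S.fibre_ext (fun {s' r'} g hg z => ?_) z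
  rw [sum_apply]
  simp only [S.lact_incl, extendOp_apply]
  by_cases hr : r' = r
  · rw [Finset.sum_eq_single_of_mem ⟨s', r', g, hg⟩ (by simpa using hr)]
    · simp only [S.proj_incl_self]
    · intro q _ hq
      rw [S.proj_incl_of_ne q.hom q.degree_eq g hg hq, map_zero, S.incl_zero]
  · rw [Finset.sum_eq_zero, C0Sum.single_apply_of_ne hr]
    · simp only [map_zero, zero_apply, S.incl_zero]
    · intro q hq
      rw [S.proj_incl_of_ne q.hom q.degree_eq g hg, map_zero, S.incl_zero]
      intro e
      have hq' : q.rng = r := by simpa using hq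
      exact hr ((congrArg KGraph.Path.rng e).symm.trans hq')

/-- Elements supported at one vertex act as finite sums of extended compact operators, by
row-finiteness. They span a dense subspace of `A`, and the left action is continuous into a space
where the compact operators are closed. -/
theorem fibre_lact_mem_compactOperators (hD : D.IsRowFiniteNoSources)
    (h : ∀ {s r : Λ} (f : s ⟶ r) (b : S.A r), (S.X f).lact b ∈ (S.X f).compactOperators)
    (n : Fin k → ℕ) (b : C0Sum S.A) : (S.fibre n).lact b ∈ (S.fibre n).compactOperators := by
  refine (S.fibre n).lactL.mem_of_mem_closure_span (Submodule.isClosed_topologicalClosure _) ?_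
    (Submodule.mem_of_eq_top (C0Sum.span_single_dense (A := S.A)) b)
  rintro _ ⟨r, b, rfl⟩
  have hsum := Submodule.sum_mem (S.fibre n).compactOperators
    fun p (_ : p ∈ (hD r n).1.toFinset) => S.extendOp_mem_compactOperators p.hom p.degree_eq
      (h p.hom ((C0Sum.single S.A r b).1 p.rng))
  rwa [← S.lact_single_eq_sum r (hD r n).1 b] at hsum

end LambdaSystem

theorem proposition3p1p7 {k : ℕ} {Λ : Type u} [CategoryTheory.Category.{v} Λ] (D : KGraph k Λ)
    (S : LambdaSystem.{u, v, w, a} D) :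
    (∃! Y : ProductSystem S.fibre,
      (∀ (v : Λ) (e : S.X (𝟙 v)),
        Y.unit (S.incl (𝟙 v) (D.degree_id v) e) = C0Sum.single S.A v (S.unit v e)) ∧
      (∀ {u v w : Λ} {m n : Fin k → ℕ} (α : v ⟶ w) (β : u ⟶ v) (hα : D.degree α = m)
        (hβ : D.degree β = n) (x : S.X α) (y : S.X β),
        Y.mul (S.incl α hα x) (S.incl β hβ y)
          = S.incl (β ≫ α) (by rw [D.degree_comp, hα, hβ])
              (S.chi α β ((S.X α).tmul (S.X β) x y))) ∧
      (∀ {u v v' w : Λ} {m n : Fin k → ℕ} (α : v ⟶ w) (β : u ⟶ v') (hα : D.degree α = m)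
        (hβ : D.degree β = n) (x : S.X α) (y : S.X β), v ≠ v' →
        Y.mul (S.incl α hα x) (S.incl β hβ y) = 0)) ∧
    (S.IsRegular →
      (∀ n, (S.fibre n).IsNondegenerate) ∧
      ∀ n, Function.Injective (S.fibre n).lact ∧
        ∀ b, (S.fibre n).lact b ∈ (S.fibre n).compactOperators) := by
  refine ⟨⟨S.productSystem, ⟨S.fibreUnit_incl,
    fun α β hα hβ x y => S.fibreMul_incl α β hα hβ x y,
    fun α β hα hβ x y h => S.fibreMul_incl_of_ne α β hα hβ h x y⟩, ?_⟩,
    fun hS => ⟨?_, fun n => ⟨?_, ?_⟩⟩⟩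
  · rintro Y ⟨hu, hm, h0⟩
    refine S.productSystem_eq Y _ (fun b e => (hu b e).trans (S.fibreUnit_incl b e).symm)
      fun {m n s r s' r'} α β hα hβ x y => ?_
    by_cases h : s = r'
    · subst h
      exact (hm α β hα hβ x y).trans (S.fibreMul_incl α β hα hβ x y).symm
    · exact (h0 α β hα hβ x y h).trans (S.fibreMul_incl_of_ne α β hα hβ h x y).symm
  · exact S.fibre_isNondegenerate hS.nondegenerate
  · exact S.fibre_lact_injective hS.rowFiniteNoSources hS.injective n
  · exact S.fibre_lact_mem_compactOperators hS.rowFiniteNoSources hS.compact n
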